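/- **Theorem 5.4.** Let $k$ be an algebraically closed field of characteristic $p>0$, let $X$ be a smooth irreducible affine variety over $k$ with coordinate ring $A=k[X]$ and function field $K=k(X)$, and write $x\in X$ for closed (that is, $k$-rational) points, $\mathfrak m_x\subset A$ for the corresponding maximal ideals. Let $\mathfrak g$ be a $p$-Lie algebra over $k$, not necessarily finite dimensional, and let $\rho:\mathfrak g\to\operatorname{Der}_kA$ be a homomorphism of $p$-Lie algebras (the $p$-map on $\operatorname{Der}_kA$ being $D\mapsto D^p$). Put $$A^{\mathfrak g}=\{a\in A\mid\rho(D)a=0\text{ for all }D\in\mathfrak g\},$$ and define $K^{\mathfrak g}$ in the same way, using the unique extensions of the derivations $\rho(D)$ to $K$. Put $\mathfrak g_x=\{D\in\mathfrak g\mid\rho(D)\mathfrak m_x\subset\mathfrak m_x\}$, $c_{\mathfrak g}(X)=\max_{x\in X}\dim_k\mathfrak g/\mathfrak g_x$ (this is finite), $A^{(p)}=\{f^p\mid f\in A\}$ and $K^{(p)}=\{f^p\mid f\in K\}$. Let $n=\dim X-c_{\mathfrak g}(X)$ and $f_1,\ldots,f_n\in A^{\mathfrak g}$. Let $U$ be the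 open set of those $x\in X$ for which the differentials $d_xf_1,\ldots,d_xf_n:T_xX\to k$ are linearly independent, where $T_xX=(\mathfrak m_x/\mathfrak m_x^2)^*$. If $U\neq\emptyset$, then $$K^{\mathfrak g}=K^{(p)}(f_1,\ldots,f_n).$$ If, moreover, $\operatorname{codim}_X(X\setminus U)\ge2$ (which is understood to hold if $U=X$), then: 1. $A^{\mathfrak g}=A^{(p)}[f_1,\ldots,f_n]$, and $A^{\mathfrak g}$ is a free module of rank $p^n$ over $A^{(p)}$. 2. $A^{\mathfrak g}$ is a locally complete intersection, i.e. it is Noetherian and each of its local rings is the quotient of a regular local ring by an ideal generated by a regular sequence. 3. If $\pi:X\to X/\mathfrak g=\operatorname{Spec}A^{\mathfrak g}$ is the canonical morphism, then $\pi(U)$ is the set of all smooth $k$-rational points of $X/\mathfrak g$. -/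

import Mathlib

noncomputable section

universe u v

/-! ### `p`-Lie algebras and their actions on affine varieties -/

/-- A `p`-Lie algebra (restricted Lie algebra) over a field `k` of characteristic `p` in the sense of Jacobson.  In the formula for
`(x + y)^[p]` the term `s_i(x, y)`, `1 ≤ i ≤ p - 1`, is defined by the rule that `i * s_i(x, y)` is the
coefficient at `t ^ (i - 1)` in `ad (t x + y) ^ (p - 1) (x)`.  Here `ad (t x + y)` is regarded as a
polynomial in the central variable `t` with coefficients in the associative ring `End_k 𝔤`. -/
class PLieAlgebra (k : Type*) (p : outParam ℕ) (𝔤 : Type*) [Field k] [LieRing 𝔤]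
    [LieAlgebra k 𝔤] where
  /-- The `p`-map `x ↦ x^[p]`. -/
  pMap : 𝔤 → 𝔤
  pMap_smul : ∀ (c : k) (x : 𝔤), pMap (c • x) = c ^ p • pMap x
  ad_pMap : ∀ x : 𝔤, LieAlgebra.ad k 𝔤 (pMap x) = (LieAlgebra.ad k 𝔤 x) ^ p
  pMap_add : ∀ x y : 𝔤, pMap (x + y) = pMap x + pMap y +
    ∑ i ∈ Finset.Icc 1 (p - 1), (i : k)⁻¹ •
      (((Polynomial.C (LieAlgebra.ad k 𝔤 x : Module.End k 𝔤) * Polynomial.X +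
        Polynomial.C (LieAlgebra.ad k 𝔤 y : Module.End k 𝔤)) ^ (p - 1)).coeff (i - 1)) x

/-- An action of the `p`-Lie algebra `𝔤` on `Spec A`: a homomorphism of `p`-Lie algebras
`ρ : 𝔤 → Der_k A`, where the `p`-map of `Der_k A` is the `p`-fold composition `D ↦ D ∘ ⋯ ∘ D`. -/
structure PLieAction (k : Type*) (p : ℕ) (𝔤 A : Type*) [Field k] [LieRing 𝔤] [LieAlgebra k 𝔤]
    [PLieAlgebra k p 𝔤] [CommRing A] [Algebra k A] where
  ρ : 𝔤 →ₗ⁅k⁆ Derivation k A A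
  map_pMap : ∀ (D : 𝔤) (a : A), ρ (PLieAlgebra.pMap k D) a = (ρ D)^[p] a

/-! ### Subrings of `p`-th powers -/

/-- `A^(p) = {f ^ p | f ∈ A}`; it is a `k`-subalgebra because `k` is algebraically closed. -/
def pthPowers (k : Type*) (p : ℕ) (A : Type*) [Field k] [IsAlgClosed k] [Fact p.Prime] [CharP k p]
    [CommRing A] [Nontrivial A] [Algebra k A] : Subalgebra k A where
  carrier := {a | ∃ f : A, f ^ p = a}
  mul_mem' := by
    rintro _ _ ⟨f, rfl⟩ ⟨g, rfl⟩
    exact ⟨f * g, mul_pow f g p⟩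
  add_mem' := by
    have : CharP A p := charP_of_injective_algebraMap (algebraMap k A).injective p
    rintro _ _ ⟨f, rfl⟩ ⟨g, rfl⟩
    exact ⟨f + g, add_pow_char f g p⟩
  algebraMap_mem' := by
    intro c
    obtain ⟨b, hb⟩ := IsAlgClosed.exists_pow_nat_eq c (Fact.out : p.Prime).pos
    exact ⟨algebraMap k A b, by rw [← map_pow, hb]⟩

/-- `K^(p) = {f ^ p | f ∈ K}` for a field `K`, as a subfield containing `k`. -/
def pthPowersField (k : Type*) (p : ℕ) (K : Type*) [Field k] [IsAlgClosed k] [Fact p.Prime]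
    [CharP k p] [Field K] [Algebra k K] : IntermediateField k K :=
  { pthPowers k p K with
    inv_mem' := by
      rintro _ ⟨f, rfl⟩
      exact ⟨f⁻¹, inv_pow f p⟩ }

/-! ### Extension of derivations to the field of fractions -/

theorem isUnit_algebraMap_end_fractions (A K : Type*) [CommRing A] [IsDomain A] [Field K]
    [Algebra A K] [IsFractionRing A K] (s : nonZeroDivisors A) :
    IsUnit (algebraMap A (Module.End A K) s) := by
  rw [Module.End.isUnit_iff]
  have hs : algebraMap A K s ≠ 0 := by
    simp
  constructor
  · intro a b hab
    simpa [Algebra.smul_def, hs] using hab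
  · intro b
    exact ⟨(algebraMap A K s)⁻¹ * b, by simp [Algebra.smul_def, hs]⟩

/-- The extension of a derivation `D` of `A` to the field of fractions `K` of `A`. -/
def Derivation.extendToFractions {k A : Type*} (K : Type*) [Field k] [CommRing A] [IsDomain A]
    [Algebra k A] [Field K] [Algebra A K] [IsFractionRing A K] [Algebra k K] [IsScalarTower k A K]
    (D : Derivation k A A) : Derivation k K K :=
  ((IsLocalizedModule.lift (nonZeroDivisors A) (KaehlerDifferential.map k k A K)
    ((Algebra.linearMap A K).comp D.liftKaehlerDifferential)
    (isUnit_algebraMap_end_fractions A K)).extendScalarsOfIsLocalization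
      (nonZeroDivisors A) K).compDer (KaehlerDifferential.D k K)

theorem Derivation.extendToFractions_algebraMap {k A : Type*} (K : Type*) [Field k] [CommRing A]
    [IsDomain A] [Algebra k A] [Field K] [Algebra A K] [IsFractionRing A K] [Algebra k K]
    [IsScalarTower k A K] (D : Derivation k A A) (a : A) :
    D.extendToFractions K (algebraMap A K a) = algebraMap A K (D a) := by
  change IsLocalizedModule.lift (nonZeroDivisors A) (KaehlerDifferential.map k k A K)
    ((Algebra.linearMap A K).comp D.liftKaehlerDifferential)
    (isUnit_algebraMap_end_fractions A K)
    (KaehlerDifferential.D k K (algebraMap A K a)) = _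
  rw [← KaehlerDifferential.map_D k k A K a, IsLocalizedModule.lift_apply]
  simp

namespace PLieAction

variable {k : Type*} {p : ℕ} {𝔤 A : Type*} [Field k] [LieRing 𝔤] [LieAlgebra k 𝔤]
  [PLieAlgebra k p 𝔤] [CommRing A] [Algebra k A]

/-! ### Invariants -/

/-- `A^𝔤 = {a ∈ A | ρ(D) a = 0 for all D ∈ 𝔤}`. -/
def invariants (act : PLieAction k p 𝔤 A) : Subalgebra k A where
  carrier := {a | ∀ D : 𝔤, act.ρ D a = 0}
  mul_mem' := by
    intro a b ha hb D
    simp [Derivation.leibniz, ha D, hb D]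
  add_mem' := by
    intro a b ha hb D
    simp [ha D, hb D]
  algebraMap_mem' := by
    intro c D
    simp

/-- `K^𝔤`, the field of invariants in the field of fractions `K` of `A`, on which `𝔤` acts by the
extended derivations. -/
def invariantField (K : Type*) [IsDomain A] [Field K] [Algebra A K] [IsFractionRing A K]
    [Algebra k K] [IsScalarTower k A K] (act : PLieAction k p 𝔤 A) : IntermediateField k K where
  carrier := {a | ∀ D : 𝔤, (act.ρ D).extendToFractions K a = 0}
  mul_mem' := by
    intro a b ha hb D
    simp [Derivation.leibniz, ha D, hb D]
  add_mem' := by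
    intro a b ha hb D
    simp [ha D, hb D]
  algebraMap_mem' := by
    intro c D
    simp
  inv_mem' := by
    intro a ha D
    simp [Derivation.leibniz_inv, ha D]

theorem pthPowers_le_invariants [IsAlgClosed k] [Fact p.Prime] [CharP k p] [Nontrivial A]
    (act : PLieAction k p 𝔤 A) : pthPowers k p A ≤ act.invariants := by
  have : CharP A p := charP_of_injective_algebraMap (algebraMap k A).injective p
  rintro _ ⟨f, rfl⟩ D
  simp [Derivation.leibniz_pow]

/-- `A^𝔤` as an algebra over its subalgebra `A^(p)`. -/
instance [IsAlgClosed k] [Fact p.Prime] [CharP k p] [Nontrivial A] (act : PLieAction k p 𝔤 A) :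
    Algebra (pthPowers k p A) act.invariants :=
  (Subalgebra.inclusion act.pthPowers_le_invariants).toAlgebra

/-- The rational points of `Spec A` are the `k`-algebra homomorphisms `x : A → k`, and `𝔪_x = ker x`.
The stabilizer `𝔤_x` consists of all `D ∈ 𝔤` such that `ρ(D)` maps `𝔪_x` into itself. -/
def stabilizer (act : PLieAction k p 𝔤 A) (x : A →ₐ[k] k) : Submodule k 𝔤 where
  carrier := {D | ∀ a ∈ RingHom.ker x, act.ρ D a ∈ RingHom.ker x}
  add_mem' := by
    intro D E hD hE a ha
    simpa using add_mem (hD a ha) (hE a ha)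
  zero_mem' := by
    intro a _
    simp
  smul_mem' := by
    intro c D hD a ha
    have := hD a ha
    simp only [RingHom.mem_ker] at this ⊢
    simp [this]

/-- `c_𝔤(X)`, the maximum (formally, the supremum in `ℕ∞`) of `codim_𝔤 𝔤_x = dim 𝔤 / 𝔤_x` over all rational points `x`. -/
def maxCodim (act : PLieAction k p 𝔤 A) : ℕ∞ :=
  ⨆ x : A →ₐ[k] k, Cardinal.toENat (Module.rank k (𝔤 ⧸ act.stabilizer x))

/-- The map on rational points given by the canonical morphism `Spec A → Spec A^𝔤`. -/
def quotientMap (act : PLieAction k p 𝔤 A) (x : A →ₐ[k] k) : act.invariants →ₐ[k] k :=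
  x.comp act.invariants.val

end PLieAction

/-! ### Geometry of affine varieties -/

section Geometry

variable {k A : Type*} [Field k] [CommRing A] [Algebra k A]

/-- The tangent space `T_x X = (𝔪_x / 𝔪_x ^ 2)^*`. -/
abbrev TangentSpaceAt (x : A →ₐ[k] k) : Type _ :=
  Module.Dual k (RingHom.ker x).Cotangent

/-- The differential `d_x f : T_x X → k`, `v ↦ v (f - f(x) mod 𝔪_x ^ 2)`. -/
def differentialAt (x : A →ₐ[k] k) (f : A) : TangentSpaceAt x →ₗ[k] k :=
  Module.Dual.eval k (RingHom.ker x).Cotangent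
    ((RingHom.ker x).toCotangent
      ⟨f - algebraMap k A (x f), by simp [RingHom.mem_ker]⟩)

/-- The set of rational points `x` at which `d_x f_1, …, d_x f_n` are linearly independent. -/
def independenceLocus (k : Type*) {A : Type*} [Field k] [CommRing A] [Algebra k A] {n : ℕ}
    (f : Fin n → A) : Set (A →ₐ[k] k) :=
  {x | LinearIndependent k fun i => differentialAt x (f i)}

/-- The codimension of a closed set `Z` of rational points of `Spec A`, i.e. the height of the ideal of
all functions vanishing on `Z` (the codimension of the empty set is `⊤`). -/
def codimension (Z : Set (A →ₐ[k] k)) : ℕ∞ :=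
  (⨅ x ∈ Z, RingHom.ker x : Ideal A).height

/-- A rational point `y` is smooth if the local ring at `y` is (formally) smooth over `k`. -/
def IsSmoothPoint (y : A →ₐ[k] k) : Prop :=
  (⟨RingHom.ker y, RingHom.ker_isPrime y⟩ : PrimeSpectrum A) ∈ Algebra.smoothLocus k A

/-- `B` is a locally complete intersection: it is Noetherian, and its local ring at each prime is the
quotient of a regular local ring by an ideal generated by a regular sequence.  For algebras
of finite type over a field this is the usual notion. -/
def IsLocallyCompleteIntersection (B : Type u) [CommRing B] : Prop :=
  IsNoetherianRing B ∧ ∀ (q : Ideal B) [q.IsPrime],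
    ∃ (R : Type u) (_ : CommRing R) (_ : IsRegularLocalRing R) (rs : List R),
      RingTheory.Sequence.IsRegular R rs ∧
        Nonempty ((R ⧸ Ideal.ofList rs) ≃+* Localization.AtPrime q)

end Geometry

end

/-! ### Reduced monomials -/

/-- The monomial `∏ i, b i ^ α i` with all exponents less than `p`. -/
def redMonomial {p : ℕ} {ι R : Type*} [Fintype ι] [CommRing R] (b : ι → R) (α : ι → Fin p) : R :=
  ∏ i, b i ^ (α i : ℕ)

theorem map_redMonomial {p : ℕ} {ι R S : Type*} [Fintype ι] [CommRing R] [CommRing S]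
    (φ : R →+* S) (b : ι → R) (α : ι → Fin p) :
    φ (redMonomial b α) = redMonomial (fun i => φ (b i)) α := by
  simp [redMonomial]

theorem redMonomial_mem_adjoin {p : ℕ} {ι F R : Type*} [Fintype ι] [CommRing F] [CommRing R]
    [Algebra F R] (b : ι → R) (α : ι → Fin p) :
    redMonomial b α ∈ Algebra.adjoin F (Set.range b) :=
  prod_mem fun i _ => pow_mem (Algebra.subset_adjoin (Set.mem_range_self i)) _

theorem mul_redMonomial_mem_span {p : ℕ} [hp : Fact p.Prime] {ι F R : Type*} [Fintype ι]
    [CommRing F] [CommRing R] [Algebra F R] (b : ι → R)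
    (hb : ∀ i, b i ^ p ∈ (algebraMap F R).range) (i : ι) (α : ι → Fin p) :
    b i * redMonomial b α ∈ Submodule.span F (Set.range (redMonomial (p := p) b)) := by
  classical
  have hprod : ∀ c : Fin p, redMonomial b (Function.update α i c) =
      b i ^ (c : ℕ) * ∏ j ∈ Finset.univ.erase i, b j ^ (α j : ℕ) := by
    intro c
    rw [redMonomial, ← Finset.mul_prod_erase _ _ (Finset.mem_univ i)]
    congr 1
    · simp
    · refine Finset.prod_congr rfl fun j hj => ?_
      rw [Function.update_of_ne (Finset.ne_of_mem_erase hj)]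
  have hα : redMonomial b α = b i ^ (α i : ℕ) * ∏ j ∈ Finset.univ.erase i, b j ^ (α j : ℕ) := by
    rw [← hprod, Function.update_eq_self]
  by_cases h : (α i : ℕ) + 1 < p
  · refine Submodule.subset_span ⟨Function.update α i ⟨α i + 1, h⟩, ?_⟩
    rw [hprod, hα]
    ring
  · obtain ⟨a, ha⟩ := hb i
    have hi : (α i : ℕ) + 1 = p := by omega
    have : b i * redMonomial b α =
        a • redMonomial b (Function.update α i ⟨0, hp.out.pos⟩) := by
      rw [hprod, hα, Algebra.smul_def, ha, ← mul_assoc, ← pow_succ', hi]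
      simp
    rw [this]
    exact Submodule.smul_mem _ _ (Submodule.subset_span ⟨_, rfl⟩)

theorem span_redMonomial_eq_adjoin {p : ℕ} [hp : Fact p.Prime] {ι F R : Type*} [Fintype ι]
    [CommRing F] [CommRing R] [Algebra F R] (b : ι → R)
    (hb : ∀ i, b i ^ p ∈ (algebraMap F R).range) :
    Submodule.span F (Set.range (redMonomial (p := p) b)) =
      Subalgebra.toSubmodule (Algebra.adjoin F (Set.range b)) := by
  apply le_antisymm
  · rw [Submodule.span_le]
    rintro _ ⟨α, rfl⟩
    exact redMonomial_mem_adjoin b α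
  · intro x hx
    rw [Subalgebra.mem_toSubmodule, Algebra.adjoin_range_eq_range_aeval] at hx
    obtain ⟨P, rfl⟩ := hx
    have one_mem : (1 : R) ∈ Submodule.span F (Set.range (redMonomial (p := p) b)) :=
      Submodule.subset_span ⟨fun _ => ⟨0, hp.out.pos⟩, by simp [redMonomial]⟩
    induction P using MvPolynomial.induction_on with
    | C a =>
      simpa [Algebra.algebraMap_eq_smul_one] using Submodule.smul_mem _ a one_mem
    | add P Q hP hQ => simpa using add_mem hP hQ
    | mul_X P i hP =>
      have key : ∀ y ∈ Submodule.span F (Set.range (redMonomial (p := p) b)),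
          b i * y ∈ Submodule.span F (Set.range (redMonomial (p := p) b)) := by
        intro y hy
        induction hy using Submodule.span_induction with
        | mem y hy =>
          obtain ⟨α, rfl⟩ := hy
          exact mul_redMonomial_mem_span b hb i α
        | zero => simp
        | add y z _ _ hy hz => simpa [mul_add] using add_mem hy hz
        | smul a y _ hy => simpa using Submodule.smul_mem _ a hy
      simpa [mul_comm] using key _ hP

/-- If the reduced monomials in `b` are linearly independent over `F`, then the relations between
the `b i` are generated by `X i ^ p - c i`, where `c i = b i ^ p`. -/
theorem ker_aeval_eq_span {p : ℕ} [hp : Fact p.Prime] {ι F R : Type*} [Fintype ι]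
    [CommRing F] [CommRing R] [Algebra F R] (b : ι → R) (c : ι → F)
    (hc : ∀ i, algebraMap F R (c i) = b i ^ p)
    (hli : LinearIndependent F (redMonomial (p := p) b)) :
    RingHom.ker (MvPolynomial.aeval b : MvPolynomial ι F →ₐ[F] R) =
      Ideal.span (Set.range fun i => MvPolynomial.X i ^ p - MvPolynomial.C (c i)) := by
  classical
  set I : Ideal (MvPolynomial ι F) :=
    Ideal.span (Set.range fun i => MvPolynomial.X i ^ p - MvPolynomial.C (c i)) with hI
  have hle : I ≤ RingHom.ker (MvPolynomial.aeval b : MvPolynomial ι F →ₐ[F] R) := by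
    rw [hI, Ideal.span_le]
    rintro _ ⟨i, rfl⟩
    simp [RingHom.mem_ker, hc]
  refine le_antisymm (fun P hP => ?_) hle
  let X' : ι → MvPolynomial ι F ⧸ I := fun i => Ideal.Quotient.mk I (MvPolynomial.X i)
  have hX' : ∀ i, X' i ^ p ∈ (algebraMap F (MvPolynomial ι F ⧸ I)).range := by
    intro i
    refine ⟨c i, ?_⟩
    have : Ideal.Quotient.mk I (MvPolynomial.X i ^ p) =
        Ideal.Quotient.mk I (MvPolynomial.C (c i)) :=
      Ideal.Quotient.eq.mpr (Ideal.subset_span ⟨i, rfl⟩)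
    rw [map_pow] at this
    exact this.symm
  have hmem : Ideal.Quotient.mk I P ∈
      Submodule.span F (Set.range (redMonomial (p := p) X')) := by
    rw [span_redMonomial_eq_adjoin X' hX', Subalgebra.mem_toSubmodule,
      Algebra.adjoin_range_eq_range_aeval]
    refine ⟨P, ?_⟩
    have : (MvPolynomial.aeval X' : MvPolynomial ι F →ₐ[F] _) = Ideal.Quotient.mkₐ F I := by
      ext i
      simp [X']
    exact DFunLike.congr_fun this P
  obtain ⟨a, ha⟩ := (Submodule.mem_span_range_iff_exists_fun F).mp hmem
  let Q : MvPolynomial ι F := ∑ α, a α • redMonomial MvPolynomial.X α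
  have hQ : Ideal.Quotient.mk I Q = Ideal.Quotient.mk I P := by
    rw [← ha]
    change Ideal.Quotient.mkₐ F I Q = _
    simp only [Q, map_sum, map_smul]
    refine Finset.sum_congr rfl fun α _ => ?_
    congr 1
    exact map_redMonomial (Ideal.Quotient.mk I) _ _
  have hPQ : P - Q ∈ I := Ideal.Quotient.eq.mp hQ.symm
  have hQ0 : MvPolynomial.aeval b Q = 0 := by
    have h1 := hle hPQ
    rw [RingHom.mem_ker, map_sub, (RingHom.mem_ker).mp hP, zero_sub, neg_eq_zero] at h1
    exact h1
  have ha0 : ∀ α, a α = 0 := by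
    refine Fintype.linearIndependent_iff.mp hli a ?_
    rw [← hQ0]
    simp only [Q, map_sum, map_smul]
    refine Finset.sum_congr rfl fun α _ => ?_
    congr 1
    have := map_redMonomial (MvPolynomial.aeval b : MvPolynomial ι F →ₐ[F] R).toRingHom
      MvPolynomial.X α
    simpa using this.symm
  have : Q = 0 := by simp [Q, ha0]
  simpa [this] using hPQ

/-! ### Derivations and independence -/

theorem Derivation.apply_aeval_mvPolynomial {ι F R : Type*} [Fintype ι] [CommRing F] [CommRing R]
    [Algebra F R] (D : Derivation F R R) (b : ι → R) (P : MvPolynomial ι F) :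
    D (MvPolynomial.aeval b P) =
      ∑ i, MvPolynomial.aeval b (MvPolynomial.pderiv i P) * D (b i) := by
  classical
  induction P using MvPolynomial.induction_on with
  | C a => simp
  | add P Q hP hQ => simp [hP, hQ, add_mul, Finset.sum_add_distrib]
  | mul_X P j hP =>
    simp only [map_mul, MvPolynomial.aeval_X, Derivation.leibniz, smul_eq_mul, hP, map_add,
      MvPolynomial.pderiv_X, add_mul, Finset.sum_add_distrib, Finset.mul_sum]
    congr 1
    · rw [Finset.sum_eq_single j]
      · simp
      · intro i _ hij
        simp [hij.symm]
      · simp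
    · refine Finset.sum_congr rfl fun i _ => by ring

theorem MvPolynomial.eq_zero_of_aeval_eq_zero_of_derivation {p : ℕ}
    {ι F R : Type*} [Fintype ι] [DecidableEq ι] [CommRing F] [IsDomain F] [CharP F p] [CommRing R]
    [Algebra F R] (hinj : Function.Injective (algebraMap F R)) (b : ι → R)
    (D : ι → Derivation F R R) (hD : ∀ i j, D i (b j) = if i = j then 1 else 0) (N : ℕ)
    (P : MvPolynomial ι F) (hN : P.totalDegree ≤ N) (hP : ∀ m ∈ P.support, ∀ i, m i < p)
    (h0 : MvPolynomial.aeval b P = 0) : P = 0 := by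
  induction N generalizing P with
  | zero =>
    rw [Nat.le_zero, MvPolynomial.totalDegree_eq_zero_iff_eq_C] at hN
    rw [hN, MvPolynomial.aeval_C] at h0
    rw [hN, hinj (h0.trans (map_zero _).symm), map_zero]
  | succ N ih =>
    have hcoeff : ∀ i m, (MvPolynomial.pderiv i P).coeff m =
        P.coeff (m + Finsupp.single i 1) * (m i + 1) :=
      fun i m => MvPolynomial.coeff_pderiv P m
    have hpd : ∀ i, MvPolynomial.pderiv i P = 0 := by
      intro i
      apply ih
      · refine Finset.sup_le fun m hm => ?_
        rw [MvPolynomial.mem_support_iff, hcoeff] at hm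
        have h1 : m + Finsupp.single i 1 ∈ P.support :=
          MvPolynomial.mem_support_iff.mpr (left_ne_zero_of_mul hm)
        have h2 := (MvPolynomial.le_totalDegree h1).trans hN
        have h3 : ((m + Finsupp.single i 1).sum fun _ e => e) = (m.sum fun _ e => e) + 1 := by
          rw [Finsupp.sum_add_index' (fun _ => rfl) (fun _ _ _ => rfl),
            Finsupp.sum_single_index rfl]
        omega
      · intro m hm j
        rw [MvPolynomial.mem_support_iff, hcoeff] at hm
        have h1 := hP _ (MvPolynomial.mem_support_iff.mpr (left_ne_zero_of_mul hm)) j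
        exact lt_of_le_of_lt (by simp) h1
      · have h1 := (D i).apply_aeval_mvPolynomial b P
        rw [h0, map_zero, Finset.sum_eq_single i] at h1
        · simpa [hD] using h1.symm
        · intro j _ hji
          simp [hD, hji.symm]
        · simp
    have hC : P = MvPolynomial.C (P.coeff 0) := by
      ext m
      rw [MvPolynomial.coeff_C]
      split_ifs with h
      · rw [h]
      · obtain ⟨i, hi⟩ : ∃ i, m i ≠ 0 := by
          by_contra! h'
          exact h (Finsupp.ext fun i => (h' i).symm)
        by_contra hne
        have h1 := hP m (MvPolynomial.mem_support_iff.mpr hne) i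
        have h2 := hcoeff i (m - Finsupp.single i 1)
        have h3 : m - Finsupp.single i 1 + Finsupp.single i 1 = m :=
          tsub_add_cancel_of_le (by simpa [Nat.one_le_iff_ne_zero] using hi)
        rw [hpd, h3, MvPolynomial.coeff_zero] at h2
        have h4 : (((m i : ℕ) : F)) = 0 := by
          have h5 : (((m - Finsupp.single i 1 : ι →₀ ℕ) i : ℕ) : F) + 1 = ((m i : ℕ) : F) := by
            rw [← Nat.cast_add_one]
            congr 1
            simp
            omega
          rw [← h5]
          exact (mul_eq_zero.mp h2.symm).resolve_left hne
        rw [CharP.cast_eq_zero_iff F p] at h4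
        exact absurd (Nat.le_of_dvd (Nat.pos_of_ne_zero hi) h4) (by omega)
    rw [hC, MvPolynomial.aeval_C] at h0
    rw [hC, hinj (h0.trans (map_zero _).symm), map_zero]

/-- Derivations dual to `b` force the reduced monomials in `b` to be linearly independent over the
constants. -/
theorem linearIndependent_redMonomial_of_derivation {p : ℕ} [Fact p.Prime]
    {ι F R : Type*} [Fintype ι] [DecidableEq ι] [CommRing F] [IsDomain F] [CharP F p] [CommRing R]
    [Algebra F R] (hinj : Function.Injective (algebraMap F R)) (b : ι → R)
    (D : ι → Derivation F R R) (hD : ∀ i j, D i (b j) = if i = j then 1 else 0) :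
    LinearIndependent F (redMonomial (p := p) b) := by
  rw [Fintype.linearIndependent_iff]
  intro c hc
  let e : (ι → Fin p) → (ι →₀ ℕ) := fun α => Finsupp.equivFunOnFinite.symm fun i => (α i : ℕ)
  have he : Function.Injective e := by
    intro α β h
    ext i
    exact DFunLike.congr_fun h i
  let P : MvPolynomial ι F := ∑ α, MvPolynomial.monomial (e α) (c α)
  have hPc : ∀ α, P.coeff (e α) = c α := by
    intro α
    simp only [P, MvPolynomial.coeff_sum, MvPolynomial.coeff_monomial]
    rw [Finset.sum_eq_single α]
    · simp
    · intro β _ hβ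
      rw [if_neg (fun h => hβ (he h))]
    · simp
  have hP : P = 0 := by
    refine MvPolynomial.eq_zero_of_aeval_eq_zero_of_derivation (p := p) hinj b D hD _ P le_rfl ?_ ?_
    · intro m hm i
      by_contra hmi
      refine MvPolynomial.mem_support_iff.mp hm ?_
      simp only [P, MvPolynomial.coeff_sum, MvPolynomial.coeff_monomial]
      refine Finset.sum_eq_zero fun α _ => if_neg ?_
      rintro rfl
      exact hmi (α i).2
    · rw [← hc]
      simp only [P, map_sum, MvPolynomial.aeval_monomial]
      refine Finset.sum_congr rfl fun α _ => ?_
      rw [Algebra.smul_def]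
      congr 1
      rw [Finsupp.prod_fintype _ _ (by simp)]
      rfl
  intro α
  rw [← hPc, hP, MvPolynomial.coeff_zero]

theorem exists_dual_derivation_of_isUnit_det {ι k R : Type*} [Fintype ι] [DecidableEq ι]
    [CommRing k] [CommRing R] [Algebra k R] (D : ι → Derivation k R R) (b : ι → R)
    (h : IsUnit (Matrix.of fun i j => D i (b j)).det) :
    ∃ M : Matrix ι ι R, ∀ i j, (∑ l, M i l • D l) (b j) = if i = j then 1 else 0 := by
  refine ⟨(Matrix.of fun i j => D i (b j))⁻¹, fun i j => ?_⟩
  have h1 := congrFun (congrFun (Matrix.nonsing_inv_mul _ h) i) j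
  rw [Matrix.one_apply, Matrix.mul_apply] at h1
  rw [← h1]
  change Derivation.coeFnAddMonoidHom (∑ l, _) (b j) = _
  rw [map_sum, Finset.sum_apply]
  rfl

/-- A derivation that vanishes on a base ring `F` is `F`-linear. -/
def Derivation.extendBase {k F R : Type*} [CommRing k] [CommRing F] [CommRing R] [Algebra k R]
    [Algebra F R] (D : Derivation k R R) (h : ∀ a : F, D (algebraMap F R a) = 0) :
    Derivation F R R :=
  Derivation.mk'
    { toFun := D
      map_add' := D.map_add
      map_smul' := fun a x => by simp [Algebra.smul_def, h] }
    fun a b => D.leibniz a b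

/-! ### Krull dimension of integral extensions -/

theorem ringKrullDim_le_of_isIntegral {R S : Type*} [CommRing R] [CommRing S] [IsDomain S]
    [Algebra R S] [Algebra.IsIntegral R S] (hinj : Function.Injective (algebraMap R S)) :
    ringKrullDim R ≤ ringKrullDim S := by
  refine iSup_le fun l => ?_
  obtain ⟨Q, hQ, hQl⟩ := Ideal.exists_ideal_over_prime_of_isIntegral_of_isDomain (S := S)
    l.head.asIdeal (by rw [(RingHom.injective_iff_ker_eq_bot _).mp hinj]; exact bot_le)
  have : Q.LiesOver l.head.asIdeal := ⟨hQl.symm⟩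
  obtain ⟨L, hL, -⟩ := Ideal.exists_ltSeries_of_hasGoingUp l Q
  rw [← hL]
  exact le_iSup (fun l : LTSeries (PrimeSpectrum S) => (l.length : WithBot ℕ∞)) L

/-! ### Degrees over the subfield of `p`-th powers -/

section Degrees

variable {k : Type*} [Field k] [IsAlgClosed k] {p : ℕ} [hp : Fact p.Prime] [CharP k p]

/-- The isomorphism `f ↦ f ^ p` from a reduced ring onto its subring of `p`-th powers. -/
noncomputable def equivPthPowers (k : Type*) [Field k] [IsAlgClosed k] (p : ℕ) [Fact p.Prime]
    [CharP k p] (A : Type*) [CommRing A] [IsDomain A] [Algebra k A] : A ≃+* pthPowers k p A :=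
  have : CharP A p := charP_of_injective_algebraMap (algebraMap k A).injective p
  RingEquiv.ofBijective ((frobenius A p).codRestrict (pthPowers k p A) fun f => ⟨f, rfl⟩) <| by
    constructor
    · intro a b h
      exact frobenius_inj A p (Subtype.ext_iff.mp h)
    · rintro ⟨_, f, rfl⟩
      exact ⟨f, rfl⟩

theorem finrank_pthPowersField_eq (E K : Type*) [Field E] [Field K] [Algebra k E] [Algebra k K]
    [Algebra E K] [IsScalarTower k E K] [FiniteDimensional E K] :
    Module.finrank (pthPowersField k p E) E = Module.finrank (pthPowersField k p K) K := by
  have hcharE : CharP E p := charP_of_injective_algebraMap (algebraMap k E).injective p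
  let φ : pthPowersField k p E →+* pthPowersField k p K :=
    ((algebraMap E K).comp (pthPowersField k p E).val.toRingHom).codRestrict (pthPowersField k p K)
      (by
        rintro ⟨_, f, rfl⟩
        exact ⟨algebraMap E K f, (map_pow _ _ _).symm⟩)
  let : Algebra (pthPowersField k p E) (pthPowersField k p K) := φ.toAlgebra
  have : IsScalarTower (pthPowersField k p E) (pthPowersField k p K) K :=
    IsScalarTower.of_algebraMap_eq fun x => rfl
  have h1 := Module.finrank_mul_finrank (pthPowersField k p E) E K
  have h2 := Module.finrank_mul_finrank (pthPowersField k p E) (pthPowersField k p K) K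
  have h3 : Module.finrank E K =
      Module.finrank (pthPowersField k p E) (pthPowersField k p K) := by
    refine Algebra.finrank_eq_of_equiv_equiv (equivPthPowers k p E) (equivPthPowers k p K) ?_
    ext x
    change algebraMap E K (x ^ p) = (algebraMap E K x) ^ p
    rw [map_pow]
  have h4 : 0 < Module.finrank E K := Module.finrank_pos
  rw [← h3] at h2
  rw [← h2, mul_comm] at h1
  exact Nat.eq_of_mul_eq_mul_left h4 h1

theorem finiteDimensional_pthPowersField (E K : Type*) [Field E] [Field K] [Algebra k E]
    [Algebra k K] [Algebra E K] [IsScalarTower k E K] [FiniteDimensional E K]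
    [FiniteDimensional (pthPowersField k p E) E] : FiniteDimensional (pthPowersField k p K) K := by
  refine Module.finite_of_finrank_pos ?_
  rw [← finrank_pthPowersField_eq E K]
  exact Module.finrank_pos

theorem pow_mem_range_algebraMap_pthPowersField {K : Type*} [Field K] [Algebra k K] (a : K) :
    a ^ p ∈ (algebraMap (pthPowersField k p K) K).range :=
  ⟨⟨a ^ p, a, rfl⟩, rfl⟩

/-- If `t` generates the field `E` over `k`, then the reduced monomials in `t` span `E` over its
subfield of `p`-th powers. -/
theorem span_redMonomial_eq_top_of_adjoin_eq_top {E : Type*} [Field E] [Algebra k E] {ι : Type*}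
    [Fintype ι] (t : ι → E) (ht : IntermediateField.adjoin k (Set.range t) = ⊤) :
    Submodule.span (pthPowersField k p E) (Set.range (redMonomial (p := p) t)) = ⊤ := by
  rw [span_redMonomial_eq_adjoin t fun i => pow_mem_range_algebraMap_pthPowersField (t i)]
  have halg : ∀ x ∈ Set.range t, IsAlgebraic (pthPowersField k p E) x := by
    intro x _
    exact IsIntegral.isAlgebraic <| IsIntegral.of_pow hp.out.pos <| by
      obtain ⟨a, ha⟩ := pow_mem_range_algebraMap_pthPowersField (k := k) (p := p) x
      rw [← ha]
      exact isIntegral_algebraMap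
  rw [← IntermediateField.adjoin_toSubalgebra_of_isAlgebraic halg]
  rw [eq_top_iff]
  intro x _
  have hx : x ∈ IntermediateField.adjoin k (Set.range t) := ht ▸ IntermediateField.mem_top
  have hle : IntermediateField.adjoin k (Set.range t) ≤
      (IntermediateField.adjoin (pthPowersField k p E) (Set.range t)).restrictScalars k := by
    rw [IntermediateField.adjoin_le_iff]
    exact IntermediateField.subset_adjoin _ _
  exact hle hx

theorem finiteDimensional_and_finrank_le_of_adjoin_eq_top {E : Type*} [Field E] [Algebra k E]
    {ι : Type*} [Fintype ι] (t : ι → E) (ht : IntermediateField.adjoin k (Set.range t) = ⊤) :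
    FiniteDimensional (pthPowersField k p E) E ∧
      Module.finrank (pthPowersField k p E) E ≤ p ^ Fintype.card ι := by
  classical
  have h := span_redMonomial_eq_top_of_adjoin_eq_top (p := p) t ht
  refine ⟨⟨⟨(Set.finite_range (redMonomial (p := p) t)).toFinset, by simpa using h⟩⟩, ?_⟩
  have h1 := finrank_range_le_card (R := pthPowersField k p E) (redMonomial (p := p) t)
  rw [Set.finrank, h, finrank_top] at h1
  simpa using h1

/-- The degree of the function field of an affine variety over its subfield of `p`-th powers. -/
theorem finiteDimensional_and_finrank_le_of_finiteType {A : Type*} [CommRing A] [IsDomain A]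
    [Algebra k A] [Algebra.FiniteType k A] (K : Type*) [Field K] [Algebra A K] [IsFractionRing A K]
    [Algebra k K] [IsScalarTower k A K] (d : ℕ) (hd : ringKrullDim A ≤ d) :
    FiniteDimensional (pthPowersField k p K) K ∧
      Module.finrank (pthPowersField k p K) K ≤ p ^ d := by
  obtain ⟨s, g, hg, hfin⟩ := exists_finite_inj_algHom_of_fg k A
  have hsd : s ≤ d := by
    let := g.toRingHom.toAlgebra
    have : Algebra.IsIntegral (MvPolynomial (Fin s) k) A := ⟨hfin.to_isIntegral⟩
    have h1 := (ringKrullDim_le_of_isIntegral (R := MvPolynomial (Fin s) k) (S := A) hg).trans hd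
    rw [MvPolynomial.ringKrullDim_of_isNoetherianRing, ringKrullDim_eq_zero_of_field] at h1
    simpa using h1
  let t : Fin s → K := fun i => algebraMap A K (g (MvPolynomial.X i))
  let E : IntermediateField k K := IntermediateField.adjoin k (Set.range t)
  have hgE : ∀ P, algebraMap A K (g P) ∈ E := by
    intro P
    have : algebraMap A K (g P) = MvPolynomial.aeval t P := by
      have : (MvPolynomial.aeval t : MvPolynomial (Fin s) k →ₐ[k] K) =
          (IsScalarTower.toAlgHom k A K).comp g := by
        ext i
        simp [t]
      rw [this]
      rfl
    rw [this]
    exact IntermediateField.algebra_adjoin_le_adjoin k _ <| by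
      rw [Algebra.adjoin_range_eq_range_aeval]
      exact ⟨P, rfl⟩
  have hE : FiniteDimensional E K := by
    let := g.toRingHom.toAlgebra
    have hmf : Module.Finite (MvPolynomial (Fin s) k) A := hfin
    obtain ⟨S, hS⟩ := hmf.fg_top
    have hSint : ∀ x ∈ algebraMap A K '' (S : Set A), IsIntegral E x := by
      rintro _ ⟨a, -, rfl⟩
      obtain ⟨P, hP, hPa⟩ := hfin.to_isIntegral a
      refine ⟨P.map (((algebraMap A K).comp g.toRingHom).codRestrict E hgE), hP.map _, ?_⟩
      rw [Polynomial.eval₂_map]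
      have := congrArg (algebraMap A K) hPa
      rw [Polynomial.hom_eval₂, map_zero] at this
      exact this
    have hfd : FiniteDimensional E (IntermediateField.adjoin E (algebraMap A K '' (S : Set A))) :=
      IntermediateField.finiteDimensional_adjoin hSint
    have htop : IntermediateField.adjoin E (algebraMap A K '' (S : Set A)) = ⊤ := by
      rw [eq_top_iff]
      have hA : ∀ a : A, algebraMap A K a ∈
          IntermediateField.adjoin E (algebraMap A K '' (S : Set A)) := by
        intro a
        have ha : a ∈ Submodule.span (MvPolynomial (Fin s) k) (S : Set A) := hS ▸ Submodule.mem_top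
        induction ha using Submodule.span_induction with
        | mem x hx => exact IntermediateField.subset_adjoin _ _ ⟨x, hx, rfl⟩
        | zero => simp
        | add x y _ _ hx hy => rw [map_add]; exact add_mem hx hy
        | smul P x _ hx =>
          rw [Algebra.smul_def, map_mul]
          refine mul_mem ?_ hx
          exact IntermediateField.algebraMap_mem _ (⟨_, hgE P⟩ : E)
      intro x _
      obtain ⟨a, b, hb, rfl⟩ := IsFractionRing.div_surjective (A := A) x
      exact div_mem (hA a) (hA b)
    rw [htop] at hfd
    exact LinearEquiv.finiteDimensional IntermediateField.topEquiv.toLinearEquiv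
  let t' : Fin s → E := fun i => ⟨t i, IntermediateField.subset_adjoin _ _ ⟨i, rfl⟩⟩
  have ht' : IntermediateField.adjoin k (Set.range t') = ⊤ := by
    apply IntermediateField.map_injective E.val
    rw [IntermediateField.adjoin_map, ← Set.range_comp, ← AlgHom.fieldRange_eq_map,
      IntermediateField.fieldRange_val]
    rfl
  obtain ⟨h1, h2⟩ := finiteDimensional_and_finrank_le_of_adjoin_eq_top (p := p) t' ht'
  refine ⟨finiteDimensional_pthPowersField E K, ?_⟩
  rw [← finrank_pthPowersField_eq E K]
  refine h2.trans ?_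
  rw [Fintype.card_fin]
  exact Nat.pow_le_pow_right hp.out.pos hsd

end Degrees

/-! ### Point derivations -/

section PointDerivations

variable {k A : Type*} [Field k] [CommRing A] [Algebra k A]

/-- `δ : A → k` is a derivation at the rational point `x`. -/
def IsPointDerivation (x : A →ₐ[k] k) (δ : A →ₗ[k] k) : Prop :=
  ∀ a b, δ (a * b) = x a * δ b + x b * δ a

theorem IsPointDerivation.map_algebraMap {x : A →ₐ[k] k} {δ : A →ₗ[k] k}
    (h : IsPointDerivation x δ) (c : k) : δ (algebraMap k A c) = 0 := by
  have h1 : δ 1 = 0 := by simpa using h 1 1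
  rw [Algebra.algebraMap_eq_smul_one, map_smul, h1, smul_zero]

theorem IsPointDerivation.map_of_mem_sq {x : A →ₐ[k] k} {δ : A →ₗ[k] k}
    (h : IsPointDerivation x δ) {a : A} (ha : a ∈ RingHom.ker x ^ 2) : δ a = 0 := by
  rw [pow_two] at ha
  induction ha using Submodule.mul_induction_on' with
  | mem_mul_mem a ha b hb =>
    rw [h, (RingHom.mem_ker).mp ha, (RingHom.mem_ker).mp hb, zero_mul, zero_mul, add_zero]
  | add a _ b _ ha hb => rw [map_add, ha, hb, add_zero]

instance isPrime_ker_algHom (x : A →ₐ[k] k) : (RingHom.ker x).IsPrime := RingHom.ker_isPrime x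

/-- The class of `a - a(x)` in the cotangent space at `x`. -/
def cotangentClass (x : A →ₐ[k] k) : A →ₗ[k] (RingHom.ker x).Cotangent where
  toFun a := (RingHom.ker x).toCotangent ⟨a - algebraMap k A (x a), by simp [RingHom.mem_ker]⟩
  map_add' a b := by
    rw [← map_add]
    congr 1
    ext
    simp
    ring
  map_smul' c a := by
    rw [RingHom.id_apply, ← LinearMap.CompatibleSMul.map_smul]
    congr 1
    ext
    simp [Algebra.smul_def, mul_sub]

theorem differentialAt_eq_eval (x : A →ₐ[k] k) (a : A) :
    differentialAt x a = Module.Dual.eval k _ (cotangentClass x a) := rfl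

theorem cotangentClass_of_mem {x : A →ₐ[k] k} {a : A} (ha : a ∈ RingHom.ker x) :
    cotangentClass x a = (RingHom.ker x).toCotangent ⟨a, ha⟩ := by
  change (RingHom.ker x).toCotangent _ = _
  congr 1
  ext
  simp [(RingHom.mem_ker).mp ha]

theorem cotangentClass_surjective (x : A →ₐ[k] k) (v : (RingHom.ker x).Cotangent) :
    ∃ a ∈ RingHom.ker x, cotangentClass x a = v := by
  obtain ⟨⟨a, ha⟩, rfl⟩ := (RingHom.ker x).toCotangent_surjective v
  exact ⟨a, ha, cotangentClass_of_mem ha⟩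

theorem cotangentClass_mul (x : A →ₐ[k] k) (a b : A) :
    cotangentClass x (a * b) = x a • cotangentClass x b + x b • cotangentClass x a := by
  rw [← map_smul, ← map_smul, ← map_add]
  change (RingHom.ker x).toCotangent _ = (RingHom.ker x).toCotangent _
  rw [Ideal.toCotangent_eq]
  have h : ∀ c, c - algebraMap k A (x c) ∈ RingHom.ker x := fun c => by simp [RingHom.mem_ker]
  rw [pow_two]
  convert Ideal.mul_mem_mul (h a) (h b) using 1
  simp only [Algebra.smul_def, map_mul, map_add, AlgHom.commutes, Algebra.algebraMap_self,
    RingHom.id_apply]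
  ring

theorem isPointDerivation_dual_cotangentClass (x : A →ₐ[k] k)
    (φ : Module.Dual k (RingHom.ker x).Cotangent) :
    IsPointDerivation x (φ ∘ₗ cotangentClass x) := fun a b => by
  simp [cotangentClass_mul]

theorem IsPointDerivation.exists_dual {x : A →ₐ[k] k} {δ : A →ₗ[k] k}
    (h : IsPointDerivation x δ) :
    ∃ φ : Module.Dual k (RingHom.ker x).Cotangent, φ ∘ₗ cotangentClass x = δ := by
  have hs : Function.Surjective (cotangentClass x) := fun v =>
    (cotangentClass_surjective x v).imp fun _ h => h.2
  obtain ⟨s, hs⟩ := (cotangentClass x).exists_rightInverse_of_surjective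
    (LinearMap.range_eq_top.mpr hs)
  refine ⟨δ ∘ₗ s, ?_⟩
  ext a
  have h1 : cotangentClass x (s (cotangentClass x a)) = cotangentClass x a :=
    LinearMap.congr_fun hs _
  set b := s (cotangentClass x a)
  change δ b = δ a
  have h2 : b - algebraMap k A (x b) - (a - algebraMap k A (x a)) ∈ RingHom.ker x ^ 2 :=
    (Ideal.toCotangent_eq _).mp h1
  have h3 := h.map_of_mem_sq h2
  rw [map_sub, map_sub, map_sub, h.map_algebraMap, h.map_algebraMap] at h3
  simpa [sub_eq_zero] using h3

theorem exists_dual_family {ι V : Type*} [Fintype ι] [DecidableEq ι] [AddCommGroup V] [Module k V]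
    {v : ι → V} (hv : LinearIndependent k v) :
    ∃ φ : ι → Module.Dual k V, ∀ i j, φ i (v j) = if i = j then 1 else 0 := by
  obtain ⟨g, hg⟩ := (Fintype.linearCombination k v).exists_leftInverse_of_injective <| by
    rw [LinearMap.ker_eq_bot]
    exact hv.fintypeLinearCombination_injective
  refine ⟨fun i => LinearMap.proj i ∘ₗ g, fun i j => ?_⟩
  have h := LinearMap.congr_fun hg (Pi.single j 1)
  rw [LinearMap.comp_apply, Fintype.linearCombination_apply_single, one_smul] at h
  simp [h, Pi.single_apply]

theorem linearIndependent_of_dual_family {ι V : Type*} [Fintype ι] [DecidableEq ι]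
    [AddCommGroup V] [Module k V] {v : ι → V} (φ : ι → Module.Dual k V)
    (h : ∀ i j, φ i (v j) = if i = j then 1 else 0) : LinearIndependent k v := by
  rw [Fintype.linearIndependent_iff]
  intro c hc i
  have := congrArg (φ i) hc
  simpa [h] using this

theorem linearIndependent_differentialAt_iff {ι : Type*} (x : A →ₐ[k] k) (f : ι → A) :
    LinearIndependent k (fun i => differentialAt x (f i)) ↔
      LinearIndependent k fun i => cotangentClass x (f i) := by
  simp only [differentialAt_eq_eval]
  refine LinearMap.linearIndependent_iff (Module.Dual.eval k _) ?_
  exact LinearMap.ker_eq_bot.mpr (Module.eval_apply_injective k)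

/-- Differentials at `x` are linearly independent if and only if there are dual point
derivations. -/
theorem linearIndependent_cotangentClass_iff {ι : Type*} [Fintype ι] [DecidableEq ι]
    (x : A →ₐ[k] k) (f : ι → A) :
    LinearIndependent k (fun i => cotangentClass x (f i)) ↔
      ∃ δ : ι → A →ₗ[k] k, (∀ i, IsPointDerivation x (δ i)) ∧
        ∀ i j, δ i (f j) = if i = j then 1 else 0 := by
  constructor
  · intro h
    obtain ⟨φ, hφ⟩ := exists_dual_family h
    exact ⟨fun i => φ i ∘ₗ cotangentClass x,
      fun i => isPointDerivation_dual_cotangentClass x (φ i), hφ⟩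
  · rintro ⟨δ, hδ, h⟩
    choose φ hφ using fun i => (hδ i).exists_dual
    refine linearIndependent_of_dual_family φ fun i j => ?_
    rw [← h, ← hφ]
    rfl

theorem exists_dual_vectors {ι V : Type*} [Fintype ι] [DecidableEq ι] [AddCommGroup V]
    [Module k V] {δ : ι → Module.Dual k V} (h : LinearIndependent k δ) :
    ∃ v : ι → V, ∀ i j, δ i (v j) = if i = j then 1 else 0 := by
  have hsurj : LinearMap.range (LinearMap.pi δ) = ⊤ := by
    by_contra hne
    obtain ⟨φ, hφ, hφ'⟩ := Submodule.exists_le_ker_of_lt_top _ (lt_top_iff_ne_top.mpr hne)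
    have h0 : ∀ i, φ (Pi.single i 1) = 0 := by
      refine Fintype.linearIndependent_iff.mp h (fun i => φ (Pi.single i 1)) ?_
      ext v
      have h1 : φ (LinearMap.pi δ v) = 0 := hφ' ⟨v, rfl⟩
      rw [LinearMap.pi_apply_eq_sum_univ] at h1
      have h2 : ∀ i : ι, (fun j => if i = j then (1 : k) else 0) = Pi.single i 1 := fun i => by
        ext j
        simp [Pi.single_apply, eq_comm]
      simpa [mul_comm, h2] using h1
    refine hφ (LinearMap.pi_ext' fun i => LinearMap.ext_ring ?_)
    simpa using h0 i
  choose v hv using fun j => LinearMap.range_eq_top.mp hsurj (Pi.single j 1)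
  refine ⟨v, fun i j => ?_⟩
  have := congrFun (hv j) i
  simpa [Pi.single_apply] using this

/-! ### Lifting point derivations at smooth points -/

theorem exists_derivation_localization_of_isPointDerivation (y : A →ₐ[k] k)
    [Algebra.FormallySmooth k (Localization.AtPrime (RingHom.ker y))] {δ : A →ₗ[k] k}
    (hδ : IsPointDerivation y δ) :
    ∃ D : Derivation k (Localization.AtPrime (RingHom.ker y))
        (Localization.AtPrime (RingHom.ker y)),
      ∀ a, IsLocalRing.residue _ (D (algebraMap A _ a)) = algebraMap k _ (δ a) := by
  set O := Localization.AtPrime (RingHom.ker y)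
  have hres : ∀ a : A, algebraMap A (IsLocalRing.ResidueField O) a = algebraMap k _ (y a) := by
    intro a
    rw [IsScalarTower.algebraMap_apply k A (IsLocalRing.ResidueField O), ← sub_eq_zero, ← map_sub,
      IsScalarTower.algebraMap_apply A O (IsLocalRing.ResidueField O)]
    refine (IsLocalRing.residue_eq_zero_iff _).mpr ?_
    rw [IsLocalization.AtPrime.to_map_mem_maximal_iff O (RingHom.ker y)]
    simp [RingHom.mem_ker]
  let d : Derivation k A (IsLocalRing.ResidueField O) :=
    Derivation.mk' (Algebra.linearMap k _ ∘ₗ δ) fun a b => by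
      simp [hδ a b, Algebra.smul_def, hres]
  have hunit : ∀ s : (RingHom.ker y).primeCompl,
      IsUnit (algebraMap A (Module.End A (IsLocalRing.ResidueField O)) s) := by
    intro s
    have h1 : IsUnit (algebraMap A (IsLocalRing.ResidueField O) s) := by
      rw [hres]
      exact (IsUnit.mk0 (y s) s.2).map _
    obtain ⟨u, hu⟩ := h1
    rw [Module.End.isUnit_iff]
    constructor
    · intro a b hab
      simpa [Algebra.smul_def, ← hu] using hab
    · intro b
      exact ⟨(↑u⁻¹ : IsLocalRing.ResidueField O) * b, by simp [Algebra.smul_def, ← hu]⟩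
  let ψ : Ω[O⁄k] →ₗ[O] IsLocalRing.ResidueField O :=
    (IsLocalizedModule.lift (RingHom.ker y).primeCompl (KaehlerDifferential.map k k A O)
      d.liftKaehlerDifferential hunit).extendScalarsOfIsLocalization (RingHom.ker y).primeCompl O
  have hψ : ∀ a : A, ψ (KaehlerDifferential.D k O (algebraMap A O a)) = algebraMap k _ (δ a) := by
    intro a
    change IsLocalizedModule.lift (RingHom.ker y).primeCompl (KaehlerDifferential.map k k A O)
      d.liftKaehlerDifferential hunit (KaehlerDifferential.D k O (algebraMap A O a)) = _
    rw [← KaehlerDifferential.map_D k k A O a, IsLocalizedModule.lift_apply,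
      Derivation.liftKaehlerDifferential_comp_D]
    rfl
  obtain ⟨Ψ, hΨ⟩ := Module.projective_lifting_property
    (Algebra.linearMap O (IsLocalRing.ResidueField O)) ψ IsLocalRing.residue_surjective
  refine ⟨Ψ.compDer (KaehlerDifferential.D k O), fun a => ?_⟩
  rw [← hψ, ← hΨ]
  rfl

/-- At a smooth point, elements with linearly independent differentials admit dual derivations of
the local ring. -/
theorem exists_dual_derivation_localization {ι : Type*} [Fintype ι] [DecidableEq ι]
    (y : A →ₐ[k] k) [Algebra.FormallySmooth k (Localization.AtPrime (RingHom.ker y))] (b : ι → A)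
    (hb : LinearIndependent k fun i => cotangentClass y (b i)) :
    ∃ D : ι → Derivation k (Localization.AtPrime (RingHom.ker y))
        (Localization.AtPrime (RingHom.ker y)),
      ∀ i j, D i (algebraMap A _ (b j)) = if i = j then 1 else 0 := by
  obtain ⟨δ, hδ, hδb⟩ := (linearIndependent_cotangentClass_iff y b).mp hb
  choose D hD using fun i => exists_derivation_localization_of_isPointDerivation y (hδ i)
  obtain ⟨M, hM⟩ := exists_dual_derivation_of_isUnit_det D (fun j => algebraMap A _ (b j)) <| by
    by_contra h
    rw [← mem_nonunits_iff, ← IsLocalRing.mem_maximalIdeal, ← IsLocalRing.residue_eq_zero_iff,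
      RingHom.map_det] at h
    have : (IsLocalRing.residue (Localization.AtPrime (RingHom.ker y))).mapMatrix
        (Matrix.of fun i j => D i (algebraMap A _ (b j))) = 1 := by
      ext i j
      simp [hD, hδb, Matrix.one_apply, apply_ite (algebraMap k _)]
    rw [this, Matrix.det_one] at h
    exact one_ne_zero h
  exact ⟨_, hM⟩

theorem exists_dual_derivation_fractions [IsDomain A] (K : Type*) [Field K] [Algebra A K]
    [IsFractionRing A K] [Algebra k K] [IsScalarTower k A K] {ι : Type*} [Fintype ι]
    [DecidableEq ι] (y : A →ₐ[k] k)
    [Algebra.FormallySmooth k (Localization.AtPrime (RingHom.ker y))] (b : ι → A)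
    (hb : LinearIndependent k fun i => cotangentClass y (b i)) :
    ∃ D : ι → Derivation k K K, ∀ i j, D i (algebraMap A K (b j)) = if i = j then 1 else 0 := by
  obtain ⟨D, hD⟩ := exists_dual_derivation_localization y b hb
  set O := Localization.AtPrime (RingHom.ker y)
  have hle : (RingHom.ker y).primeCompl ≤ nonZeroDivisors A :=
    (RingHom.ker y).primeCompl_le_nonZeroDivisors
  have : IsDomain O := IsLocalization.isDomain_localization hle
  let φ : O →+* K := IsLocalization.lift (M := (RingHom.ker y).primeCompl) (g := algebraMap A K)
    fun s => IsLocalization.map_units K (⟨s, hle s.2⟩ : nonZeroDivisors A)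
  let : Algebra O K := φ.toAlgebra
  have : IsScalarTower A O K :=
    IsScalarTower.of_algebraMap_eq fun a => (IsLocalization.lift_eq _ a).symm
  have : IsFractionRing O K :=
    IsFractionRing.isFractionRing_of_isDomain_of_isLocalization (RingHom.ker y).primeCompl O K
  have : IsScalarTower k O K := IsScalarTower.of_algebraMap_eq fun c => by
    rw [IsScalarTower.algebraMap_apply k A O, ← IsScalarTower.algebraMap_apply A O K,
      ← IsScalarTower.algebraMap_apply k A K]
  refine ⟨fun i => (D i).extendToFractions K, fun i j => ?_⟩
  rw [IsScalarTower.algebraMap_apply A O K, Derivation.extendToFractions_algebraMap, hD]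
  split_ifs <;> simp

end PointDerivations

section Degrees

variable {k : Type*} [Field k] [IsAlgClosed k] {p : ℕ} [hp : Fact p.Prime] [CharP k p]

theorem linearIndependent_redMonomial_pthPowersField {A : Type*} [CommRing A] [IsDomain A]
    [Algebra k A] (K : Type*) [Field K] [Algebra A K]
    [IsFractionRing A K] [Algebra k K] [IsScalarTower k A K] {ι : Type*} [Fintype ι]
    (y : A →ₐ[k] k)
    [Algebra.FormallySmooth k (Localization.AtPrime (RingHom.ker y))] (b : ι → A)
    (hb : LinearIndependent k fun i => cotangentClass y (b i)) :
    LinearIndependent (pthPowersField k p K)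
      (redMonomial (p := p) fun i => algebraMap A K (b i)) := by
  classical
  obtain ⟨D, hD⟩ := exists_dual_derivation_fractions K y b hb
  have : CharP K p := charP_of_injective_algebraMap (algebraMap k K).injective p
  have : CharP (pthPowersField k p K) p :=
    charP_of_injective_algebraMap (algebraMap k (pthPowersField k p K)).injective p
  refine linearIndependent_redMonomial_of_derivation
    (algebraMap (pthPowersField k p K) K).injective _
    (fun i => (D i).extendBase (F := pthPowersField k p K) ?_) hD
  rintro ⟨_, f, rfl⟩
  change D i (f ^ p) = 0
  simp [Derivation.leibniz_pow]

end Degrees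

namespace PLieAction

section InvariantField

variable {k : Type*} [Field k] [IsAlgClosed k] {p : ℕ} [hp : Fact p.Prime] [CharP k p]
  {𝔤 A : Type*} [LieRing 𝔤] [LieAlgebra k 𝔤] [PLieAlgebra k p 𝔤] [CommRing A] [Algebra k A]

theorem exists_le_rank_of_maxCodim_eq {k : Type*} [Field k] {p : ℕ} {𝔤 A : Type*} [LieRing 𝔤]
    [LieAlgebra k 𝔤] [PLieAlgebra k p 𝔤] [CommRing A] [Algebra k A] (act : PLieAction k p 𝔤 A)
    [Nonempty (A →ₐ[k] k)] (c : ℕ) (hc : act.maxCodim = c) :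
    ∃ x : A →ₐ[k] k, (c : Cardinal) ≤ Module.rank k (𝔤 ⧸ act.stabilizer x) := by
  by_contra! h
  have h1 : ∀ x : A →ₐ[k] k,
      Cardinal.toENat (Module.rank k (𝔤 ⧸ act.stabilizer x)) + 1 ≤ (c : ℕ∞) := by
    intro x
    obtain ⟨m, hm⟩ := Cardinal.lt_aleph0.mp ((h x).trans (Cardinal.natCast_lt_aleph0 (n := c)))
    have h2 := h x
    rw [hm] at h2 ⊢
    rw [map_natCast]
    exact_mod_cast h2
  obtain ⟨x₀⟩ := ‹Nonempty (A →ₐ[k] k)›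
  obtain ⟨d, rfl⟩ : ∃ d, c = d + 1 := by
    refine Nat.exists_eq_succ_of_ne_zero ?_
    rintro rfl
    simpa using h1 x₀
  have h2 : act.maxCodim ≤ d := by
    refine iSup_le fun x => ?_
    have := h1 x
    push_cast at this
    exact (ENat.add_le_add_iff_right ENat.one_ne_top).mp this
  rw [hc] at h2
  exact absurd (by exact_mod_cast h2 : d + 1 ≤ d) (by omega)

/-- `𝔤` contains `c` elements whose values at some rational point form a system of linearly
independent tangent vectors. -/
theorem exists_dual_of_maxCodim_eq {k : Type*} [Field k] {p : ℕ} {𝔤 A : Type*} [LieRing 𝔤]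
    [LieAlgebra k 𝔤] [PLieAlgebra k p 𝔤] [CommRing A] [Algebra k A] (act : PLieAction k p 𝔤 A)
    [Nonempty (A →ₐ[k] k)] (c : ℕ) (hc : act.maxCodim = c) :
    ∃ (x : A →ₐ[k] k) (D : Fin c → 𝔤) (a : Fin c → A),
      ∀ i j, x (act.ρ (D i) (a j)) = if i = j then 1 else 0 := by
  obtain ⟨x, hx⟩ := act.exists_le_rank_of_maxCodim_eq c hc
  obtain ⟨v, hv⟩ := Module.le_rank_iff.mp hx
  choose D hD using fun i => (act.stabilizer x).mkQ_surjective (v i)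
  let δ : Fin c → Module.Dual k A := fun i => x.toLinearMap ∘ₗ (act.ρ (D i)).toLinearMap
  have hδ : LinearIndependent k δ := by
    rw [Fintype.linearIndependent_iff]
    intro g hg
    refine Fintype.linearIndependent_iff.mp hv g ?_
    have : (∑ i, g i • D i) ∈ act.stabilizer x := by
      intro a _
      have h1 := LinearMap.congr_fun hg a
      rw [RingHom.mem_ker]
      rw [map_sum]
      change x (Derivation.coeFnAddMonoidHom (∑ i, act.ρ (g i • D i)) a) = 0
      rw [map_sum, Finset.sum_apply, map_sum]
      simpa [δ] using h1
    rw [← Submodule.ker_mkQ (act.stabilizer x), LinearMap.mem_ker, map_sum] at this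
    simpa [← hD] using this
  obtain ⟨a, ha⟩ := exists_dual_vectors hδ
  exact ⟨x, D, a, ha⟩

variable [IsDomain A] (K : Type*) [Field K] [Algebra A K] [IsFractionRing A K]
  [Algebra k K] [IsScalarTower k A K]

theorem pow_le_finrank_invariantField {k : Type*} [Field k] {p : ℕ} [Fact p.Prime] [CharP k p]
    {𝔤 A : Type*} [LieRing 𝔤] [LieAlgebra k 𝔤] [PLieAlgebra k p 𝔤] [CommRing A] [IsDomain A]
    [Algebra k A] (K : Type*) [Field K] [Algebra A K] [IsFractionRing A K] [Algebra k K]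
    [IsScalarTower k A K] (act : PLieAction k p 𝔤 A) [Nonempty (A →ₐ[k] k)] (c : ℕ)
    (hc : act.maxCodim = c) [FiniteDimensional (act.invariantField K) K] :
    p ^ c ≤ Module.finrank (act.invariantField K) K := by
  obtain ⟨x, D, a, hDa⟩ := act.exists_dual_of_maxCodim_eq c hc
  let E : Fin c → Derivation k K K := fun i => (act.ρ (D i)).extendToFractions K
  obtain ⟨M, hM⟩ := exists_dual_derivation_of_isUnit_det E (fun j => algebraMap A K (a j)) <| by
    rw [isUnit_iff_ne_zero]
    have h1 : (Matrix.of fun i j => E i (algebraMap A K (a j))) =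
        (algebraMap A K).mapMatrix (Matrix.of fun i j => act.ρ (D i) (a j)) := by
      ext i j
      simp [E, Derivation.extendToFractions_algebraMap]
    rw [h1, ← RingHom.map_det]
    intro h2
    have h3 : (Matrix.of fun i j => act.ρ (D i) (a j)).det = 0 :=
      (IsFractionRing.injective A K) (h2.trans (map_zero _).symm)
    have h4 := congrArg x h3
    rw [map_zero, AlgHom.map_det] at h4
    have h5 : x.mapMatrix (Matrix.of fun i j => act.ρ (D i) (a j)) = 1 := by
      ext i j
      simp [hDa, Matrix.one_apply]
    rw [h5, Matrix.det_one] at h4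
    exact one_ne_zero h4
  have : CharP K p := charP_of_injective_algebraMap (algebraMap k K).injective p
  have : CharP (act.invariantField K) p :=
    charP_of_injective_algebraMap (algebraMap k (act.invariantField K)).injective p
  have hli := linearIndependent_redMonomial_of_derivation (p := p)
    (algebraMap (act.invariantField K) K).injective (fun j => algebraMap A K (a j))
    (fun i => (∑ l, M i l • E l).extendBase (F := act.invariantField K) (by
      rintro ⟨z, hz⟩
      change Derivation.coeFnAddMonoidHom (∑ l, M i l • E l) z = 0
      rw [map_sum, Finset.sum_apply]
      refine Finset.sum_eq_zero fun l _ => ?_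
      change M i l • E l z = 0
      rw [hz (D l), smul_zero])) hM
  simpa using hli.fintype_card_le_finrank

theorem pthPowersField_le_invariantField (act : PLieAction k p 𝔤 A) :
    pthPowersField k p K ≤ act.invariantField K := by
  have : CharP K p := charP_of_injective_algebraMap (algebraMap k K).injective p
  rintro _ ⟨f, rfl⟩ D
  simp [Derivation.leibniz_pow]

theorem algebraMap_mem_invariantField_iff {k : Type*} [Field k] {p : ℕ} {𝔤 A : Type*} [LieRing 𝔤]
    [LieAlgebra k 𝔤] [PLieAlgebra k p 𝔤] [CommRing A] [IsDomain A] [Algebra k A] (K : Type*)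
    [Field K] [Algebra A K] [IsFractionRing A K] [Algebra k K] [IsScalarTower k A K]
    (act : PLieAction k p 𝔤 A) (a : A) :
    algebraMap A K a ∈ act.invariantField K ↔ a ∈ act.invariants := by
  refine forall_congr' fun D => ?_
  rw [Derivation.extendToFractions_algebraMap]
  exact map_eq_zero_iff _ (IsFractionRing.injective A K)

theorem finiteDimensional_invariantField (act : PLieAction k p 𝔤 A)
    [FiniteDimensional (pthPowersField k p K) K] : FiniteDimensional (act.invariantField K) K := by
  have := FiniteDimensional.right (pthPowersField k p K)
    (IntermediateField.extendScalars (act.pthPowersField_le_invariantField K)) K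
  exact this

theorem finrank_adjoin_pthPowersField {ι : Type*} [Fintype ι] (f : ι → K)
    (hf : LinearIndependent (pthPowersField k p K) (redMonomial (p := p) f)) :
    Module.finrank (pthPowersField k p K)
      (IntermediateField.adjoin (pthPowersField k p K) (Set.range f)) = p ^ Fintype.card ι := by
  classical
  have halg : ∀ x ∈ Set.range f, IsAlgebraic (pthPowersField k p K) x := by
    intro x _
    exact IsIntegral.isAlgebraic <| IsIntegral.of_pow hp.out.pos <| by
      obtain ⟨a, ha⟩ := pow_mem_range_algebraMap_pthPowersField (k := k) (p := p) x
      rw [← ha]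
      exact isIntegral_algebraMap
  have h1 : Subalgebra.toSubmodule
      (IntermediateField.adjoin (pthPowersField k p K) (Set.range f)).toSubalgebra =
      Submodule.span (pthPowersField k p K) (Set.range (redMonomial (p := p) f)) := by
    rw [IntermediateField.adjoin_toSubalgebra_of_isAlgebraic halg,
      span_redMonomial_eq_adjoin f fun i => pow_mem_range_algebraMap_pthPowersField (f i)]
  have h2 := finrank_span_eq_card hf
  rw [← h1] at h2
  simpa using h2

/-- If `f` consists of `n` invariants with `n + c = dim X` whose differentials are linearly
independent at some point, then the invariant field is generated over `K^(p)` by `f`. -/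
theorem invariantField_eq_adjoin [Algebra.FiniteType k A] (act : PLieAction k p 𝔤 A) (n : ℕ)
    (hn : ((n + act.maxCodim : ℕ∞) : WithBot ℕ∞) = ringKrullDim A)
    (f : Fin n → A) (hf : ∀ i, f i ∈ act.invariants) [Nonempty (A →ₐ[k] k)]
    (hli : LinearIndependent (pthPowersField k p K)
      (redMonomial (p := p) fun i => algebraMap A K (f i))) :
    act.invariantField K =
      (IntermediateField.adjoin (pthPowersField k p K)
        (Set.range fun i => algebraMap A K (f i))).restrictScalars k := by
  obtain ⟨c, hc⟩ : ∃ c : ℕ, act.maxCodim = c := by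
    obtain ⟨m, φ, hφ⟩ := Algebra.FiniteType.iff_quotient_mvPolynomial''.mp
      (inferInstance : Algebra.FiniteType k A)
    have h1 := ringKrullDim_le_of_surjective φ.toRingHom hφ
    rw [MvPolynomial.ringKrullDim_of_isNoetherianRing, ringKrullDim_eq_zero_of_field, ← hn] at h1
    have h2 : (n + act.maxCodim : ℕ∞) ≤ m := by
      rw [← WithBot.coe_le_coe]
      simpa using h1
    refine ENat.ne_top_iff_exists.mp (fun htop => ?_) |>.imp fun _ h => h.symm
    rw [htop] at h2
    simp at h2
  obtain ⟨hfd, hle⟩ := finiteDimensional_and_finrank_le_of_finiteType (k := k) (p := p) (A := A) K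
    (n + c) (by rw [← hn, hc]; norm_cast)
  have hfd' := act.finiteDimensional_invariantField K
  have h1 := act.pow_le_finrank_invariantField K c hc
  have h2 := finrank_adjoin_pthPowersField K (fun i => algebraMap A K (f i)) hli
  rw [Fintype.card_fin] at h2
  have h3 : IntermediateField.adjoin (pthPowersField k p K)
      (Set.range fun i => algebraMap A K (f i)) ≤
      IntermediateField.extendScalars (act.pthPowersField_le_invariantField K) := by
    rw [IntermediateField.adjoin_le_iff]
    rintro _ ⟨i, rfl⟩
    exact (act.algebraMap_mem_invariantField_iff K (f i)).mpr (hf i)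
  have h4 := Module.finrank_mul_finrank (pthPowersField k p K)
    (IntermediateField.extendScalars (act.pthPowersField_le_invariantField K)) K
  have h5 : p ^ c ≤ Module.finrank
    (IntermediateField.extendScalars (act.pthPowersField_le_invariantField K)) K := h1
  have h6 := IntermediateField.eq_of_le_of_finrank_le h3 <| by
    rw [h2]
    refine Nat.le_of_mul_le_mul_right ?_ (pow_pos hp.out.pos c)
    rw [← pow_add]
    exact (Nat.mul_le_mul_left _ h5).trans (h4.trans_le hle)
  rw [h6]
  rfl

end InvariantField

end PLieAction

/-! ### Local structure of smooth algebras over a field -/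

/-- A local ring of a smooth algebra is flat and unramified over a polynomial ring. -/
theorem exists_flat_mvPolynomial_localization {k A : Type*} [Field k] [CommRing A] [Algebra k A]
    [Algebra.Smooth k A] (P : Ideal A) [P.IsPrime] :
    ∃ (m : ℕ) (φ : MvPolynomial (Fin m) k →+* Localization.AtPrime P), φ.Flat ∧
      ((IsLocalRing.maximalIdeal (Localization.AtPrime P)).comap φ).map φ =
        IsLocalRing.maximalIdeal (Localization.AtPrime P) := by
  have hsm : Algebra.IsSmoothAt k P := by
    have : (⟨P, ‹_›⟩ : PrimeSpectrum A) ∈ Algebra.smoothLocus k A := by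
      rw [Algebra.smoothLocus_eq_univ]
      trivial
    exact this
  obtain ⟨f, hf, m, alg, -, het⟩ := hsm.exists_isStandardEtale_mvPolynomial
  have hPf : (P.map (algebraMap A (Localization.Away f))).IsPrime :=
    IsLocalization.isPrime_of_isPrime_disjoint (.powers f) _ _ ‹_›
      ((Ideal.disjoint_powers_iff_notMem_of_isPrime _).mpr hf)
  have hcomap : (P.map (algebraMap A (Localization.Away f))).comap
      (algebraMap A (Localization.Away f)) = P :=
    IsLocalization.under_map_of_isPrime_disjoint (.powers f) _ ‹_›
      ((Ideal.disjoint_powers_iff_notMem_of_isPrime _).mpr hf)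
  set Q := P.map (algebraMap A (Localization.Away f)) with hQ
  have hloc : IsLocalization.AtPrime (Localization.AtPrime Q) P := by
    convert IsLocalization.isLocalization_isLocalization_atPrime_isLocalization (.powers f)
      (Localization.AtPrime Q) Q
    exact hcomap.symm
  let e : Localization.AtPrime Q ≃ₐ[A] Localization.AtPrime P :=
    IsLocalization.algEquiv P.primeCompl _ _
  let q := Q.under (MvPolynomial (Fin m) k)
  let := Localization.AtPrime.algebraOfLiesOver q Q
  have hq : q.map (algebraMap (MvPolynomial (Fin m) k) (Localization.AtPrime Q)) =
      IsLocalRing.maximalIdeal _ :=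
    ((Algebra.isUnramifiedAt_iff_map_eq _ q Q).mp <|
      Algebra.FormallyUnramified.comp (MvPolynomial (Fin m) k) (Localization.Away f)
        (Localization.AtPrime Q)).2
  have hmax : (IsLocalRing.maximalIdeal (Localization.AtPrime Q)).comap
      (algebraMap (MvPolynomial (Fin m) k) (Localization.AtPrime Q)) = q := by
    rw [IsScalarTower.algebraMap_eq _ (Localization.Away f) (Localization.AtPrime Q),
      ← Ideal.comap_comap]
    congr 1
    exact IsLocalization.AtPrime.under_maximalIdeal _ Q
  refine ⟨m, e.toRingEquiv.toRingHom.comp (algebraMap _ (Localization.AtPrime Q)),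
    RingHom.Flat.comp ?_ (RingHom.Flat.of_bijective e.bijective), ?_⟩
  · have : Module.Flat (Localization.Away f) (Localization.AtPrime Q) :=
      IsLocalization.flat _ Q.primeCompl
    rw [IsScalarTower.algebraMap_eq _ (Localization.Away f) (Localization.AtPrime Q)]
    exact RingHom.Flat.comp (RingHom.flat_algebraMap_iff.mpr inferInstance)
      (RingHom.flat_algebraMap_iff.mpr this)
  · have : IsLocalHom e.toRingEquiv.toRingHom :=
      ⟨fun a ha => (MulEquiv.isUnit_map e.toRingEquiv).mp ha⟩
    have h1 : (IsLocalRing.maximalIdeal (Localization.AtPrime P)).comap e.toRingEquiv.toRingHom =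
        IsLocalRing.maximalIdeal (Localization.AtPrime Q) :=
      IsLocalRing.maximalIdeal_comap _
    rw [← Ideal.comap_comap, h1, hmax, ← Ideal.map_map, hq]
    exact IsLocalRing.map_ringEquiv_maximalIdeal e.toRingEquiv

theorem spanFinrank_maximalIdeal_le_height {C O : Type*} [CommRing C] [IsRegularRing C]
    [CommRing O] [IsLocalRing O] (φ : C →+* O)
    (hφ : ((IsLocalRing.maximalIdeal O).comap φ).map φ = IsLocalRing.maximalIdeal O) :
    ((IsLocalRing.maximalIdeal O).spanFinrank : ℕ∞) ≤
      ((IsLocalRing.maximalIdeal O).comap φ).height := by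
  set q := (IsLocalRing.maximalIdeal O).comap φ with hq
  let ψ : Localization.AtPrime q →+* O := IsLocalization.lift (M := q.primeCompl) (g := φ) <| by
    rintro ⟨s, hs⟩
    by_contra h
    exact hs h
  have hψ : (IsLocalRing.maximalIdeal (Localization.AtPrime q)).map ψ =
      IsLocalRing.maximalIdeal O := by
    rw [← Localization.AtPrime.map_eq_maximalIdeal, Ideal.map_map, IsLocalization.lift_comp, hφ]
  have hreg : IsRegularLocalRing (Localization.AtPrime q) :=
    IsRegularRing.isRegularLocalRing_localization q
  have h1 := hreg.spanFinrank_maximalIdeal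
  rw [IsLocalization.AtPrime.ringKrullDim_eq_height q] at h1
  have h2 : ((IsLocalRing.maximalIdeal (Localization.AtPrime q)).spanFinrank : ℕ∞) = q.height := by
    exact_mod_cast h1
  rw [← h2, Nat.cast_le]
  have fg := (IsLocalRing.maximalIdeal (Localization.AtPrime q)).fg_of_isNoetherianRing
  have h3 : Ideal.span (ψ '' (IsLocalRing.maximalIdeal (Localization.AtPrime q)).generators) =
      IsLocalRing.maximalIdeal O := by
    rw [← Ideal.map_span, Ideal.span, Submodule.span_generators, hψ]
  rw [← Submodule.FG.generators_ncard fg]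
  have h4 := (Submodule.spanFinrank_span_le_ncard_of_finite (R := O)
    ((Submodule.FG.finite_generators fg).image ψ)).trans
    (Set.ncard_image_le (Submodule.FG.finite_generators fg))
  change (Ideal.span _).spanFinrank ≤ _ at h4
  rwa [h3] at h4

theorem isRegularRing_of_smooth (k A : Type*) [Field k] [CommRing A] [Algebra k A]
    [Algebra.Smooth k A] : IsRegularRing A := by
  have : IsNoetherianRing A := Algebra.FiniteType.isNoetherianRing k A
  rw [isRegularRing_iff]
  intro P _
  obtain ⟨m, φ, hflat, hφ⟩ := exists_flat_mvPolynomial_localization (k := k) P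
  set O := Localization.AtPrime P
  have : IsNoetherianRing O := IsLocalization.isNoetherianRing P.primeCompl O inferInstance
  refine IsRegularLocalRing.of_spanFinrank_maximalIdeal_le O ?_
  rw [← IsLocalRing.maximalIdeal_height_eq_ringKrullDim]
  refine WithBot.coe_le_coe.mpr ((spanFinrank_maximalIdeal_le_height φ hφ).trans ?_)
  algebraize [φ]
  have : (IsLocalRing.maximalIdeal O).LiesOver ((IsLocalRing.maximalIdeal O).comap φ) := ⟨rfl⟩
  rw [Ideal.height_eq_height_add_of_liesOver_of_hasGoingDown
    ((IsLocalRing.maximalIdeal O).comap φ) (IsLocalRing.maximalIdeal O)]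
  exact le_self_add

theorem exists_regular_pair_of_two_le_height {C : Type*} [CommRing C] [IsDomain C]
    [UniqueFactorizationMonoid C] [IsNoetherianRing C] (q : Ideal C) [hq : q.IsPrime]
    (h : 2 ≤ q.height) :
    ∃ x ∈ q, ∃ y ∈ q, RingTheory.Sequence.IsWeaklyRegular C [x, y] := by
  have hq0 : q ≠ ⊥ := by
    rintro rfl
    simp at h
  obtain ⟨x, hxq, hx⟩ := hq.exists_mem_prime_of_ne_bot hq0
  have hlt : ¬ q ≤ Ideal.span {x} := by
    intro hle
    have h1 := (Ideal.height_mono hle).trans (Ideal.height_span_singleton_le_one hx.not_isUnit)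
    exact absurd (h.trans h1) (by decide)
  obtain ⟨y, hyq, hy⟩ := SetLike.not_le_iff_exists.mp hlt
  refine ⟨x, hxq, y, hyq, ?_⟩
  rw [RingTheory.Sequence.isWeaklyRegular_cons_iff,
    RingTheory.Sequence.isWeaklyRegular_singleton_iff]
  constructor
  · exact IsSMulRegular.of_ne_zero hx.ne_zero
  · refine (isSMulRegular_quotient_iff_mem_of_smul_mem _ _).mpr fun z hz => ?_
    rw [← Submodule.ideal_span_singleton_smul, smul_eq_mul, Ideal.mul_top,
      Ideal.mem_span_singleton] at hz ⊢
    rw [Ideal.mem_span_singleton] at hy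
    exact (hx.dvd_or_dvd hz).resolve_left hy

/-- A rational function on a smooth affine variety which is regular in codimension one is
regular. -/
theorem mem_range_algebraMap_of_two_le_height (k : Type*) {A : Type*} [Field k] [CommRing A]
    [Algebra k A] [Algebra.Smooth k A] [IsDomain A] (K : Type*) [Field K] [Algebra A K]
    [IsFractionRing A K] (b : K)
    (h : ∀ P : Ideal A, P.IsPrime → (∀ t : A, t • b ∈ (algebraMap A K).range → t ∈ P) →
      2 ≤ P.height) : b ∈ (algebraMap A K).range := by
  by_contra hb
  have : IsNoetherianRing A := Algebra.FiniteType.isNoetherianRing k A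
  let N : Submodule A K := LinearMap.range (Algebra.linearMap A K)
  have hN : ∀ z, z ∈ N ↔ z ∈ (algebraMap A K).range := fun z => Iff.rfl
  have hx : N.mkQ b ≠ 0 := by
    rw [Submodule.mkQ_apply, Ne, Submodule.Quotient.mk_eq_zero]
    exact hb
  obtain ⟨P, hP, hle⟩ := exists_le_isAssociatedPrime_of_isNoetherianRing A (N.mkQ b) hx
  obtain ⟨hPprime, y, hy⟩ := isAssociatedPrime_iff.mp hP
  obtain ⟨b', rfl⟩ := N.mkQ_surjective y
  have hcolon : ∀ (z : K) (t : A), t ∈ (⊥ : Submodule A (K ⧸ N)).colon {N.mkQ z} ↔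
      t • z ∈ (algebraMap A K).range := by
    intro z t
    rw [Submodule.mem_colon_singleton, Submodule.mem_bot, ← map_smul, Submodule.mkQ_apply,
      Submodule.Quotient.mk_eq_zero, hN]
  have hheight : 2 ≤ P.height := h P hPprime fun t ht => hle ((hcolon b t).mpr ht)
  have hmem : ∀ t, t ∈ P ↔ t • b' ∈ (algebraMap A K).range := fun t => by rw [hy, hcolon]
  obtain ⟨m, φ, hflat, hφ⟩ := exists_flat_mvPolynomial_localization (k := k) P
  set O := Localization.AtPrime P
  have : IsNoetherianRing O := IsLocalization.isNoetherianRing P.primeCompl O inferInstance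
  have hdim : 2 ≤ ((IsLocalRing.maximalIdeal O).comap φ).height := by
    refine hheight.trans (le_trans ?_ (spanFinrank_maximalIdeal_le_height φ hφ))
    rw [← WithBot.coe_le_coe, ← IsLocalization.AtPrime.ringKrullDim_eq_height P O]
    exact ringKrullDim_le_spanFinrank_maximalIdeal O
  obtain ⟨x₁, hx₁, y₁, hy₁, hreg⟩ := exists_regular_pair_of_two_le_height _ hdim
  algebraize [φ]
  have hreg' := hreg.of_flat (S := O)
  simp only [List.map_cons, List.map_nil] at hreg'
  rw [RingTheory.Sequence.isWeaklyRegular_cons_iff,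
    RingTheory.Sequence.isWeaklyRegular_singleton_iff] at hreg'
  obtain ⟨hreg1, hreg2⟩ := hreg'
  replace hreg2 := (isSMulRegular_quotient_iff_mem_of_smul_mem _ _).mp hreg2
  have hPle : P.primeCompl ≤ nonZeroDivisors A := P.primeCompl_le_nonZeroDivisors
  let ψ : O →+* K := IsLocalization.lift (M := P.primeCompl) (g := algebraMap A K)
    fun s => IsLocalization.map_units K (⟨s, hPle s.2⟩ : nonZeroDivisors A)
  have hψ : ∀ a : A, ψ (algebraMap A O a) = algebraMap A K a := IsLocalization.lift_eq _
  have hψinj : Function.Injective ψ := by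
    rw [injective_iff_map_eq_zero]
    intro o ho
    obtain ⟨a, s, rfl⟩ := IsLocalization.exists_mk'_eq P.primeCompl o
    rw [IsLocalization.lift_mk', Units.mul_left_eq_zero] at ho
    rw [(IsFractionRing.injective A K) (ho.trans (map_zero _).symm), IsLocalization.mk'_zero]
  have hnot : ∀ o : O, ψ o ≠ b' := by
    intro o ho
    obtain ⟨a, s, rfl⟩ := IsLocalization.exists_mk'_eq P.primeCompl o
    have h1 : (s : A) • b' = algebraMap A K a := by
      rw [← ho, Algebra.smul_def, ← hψ, ← map_mul, IsLocalization.mk'_spec', hψ]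
    exact s.2 ((hmem s).mpr ⟨a, h1.symm⟩)
  have hmax : ∀ o ∈ IsLocalRing.maximalIdeal O, ∃ r : O, ψ r = ψ o * b' := by
    intro o ho
    obtain ⟨a, s, rfl⟩ := IsLocalization.exists_mk'_eq P.primeCompl o
    rw [IsLocalization.AtPrime.mk'_mem_maximal_iff O P] at ho
    obtain ⟨r, hr⟩ := (hmem a).mp ho
    refine ⟨IsLocalization.mk' O r s, ?_⟩
    have hs : ψ (algebraMap A O s) ≠ 0 := by
      rw [hψ]
      exact (IsLocalization.map_units K (⟨s, hPle s.2⟩ : nonZeroDivisors A)).ne_zero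
    apply mul_left_cancel₀ hs
    rw [← map_mul, IsLocalization.mk'_spec', ← mul_assoc, ← map_mul, IsLocalization.mk'_spec', hψ,
      hψ, hr, Algebra.smul_def]
  obtain ⟨r, hr⟩ := hmax (φ x₁) hx₁
  obtain ⟨r', hr'⟩ := hmax (φ y₁) hy₁
  have h1 : φ y₁ * r = φ x₁ * r' := by
    apply hψinj
    rw [map_mul, map_mul, hr, hr']
    ring
  have h2 := hreg2 r <| by
    rw [← Submodule.ideal_span_singleton_smul, smul_eq_mul, Ideal.mul_top,
      Ideal.mem_span_singleton]
    exact ⟨r', h1⟩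
  rw [← Submodule.ideal_span_singleton_smul, smul_eq_mul, Ideal.mul_top,
    Ideal.mem_span_singleton] at h2
  obtain ⟨r'', hr''⟩ := h2
  have hx0 : ψ (φ x₁) ≠ 0 := by
    rw [Ne, map_eq_zero_iff ψ hψinj]
    intro h0
    refine one_ne_zero (α := O) (hreg1 ?_)
    change φ x₁ * 1 = φ x₁ * 0
    rw [h0, zero_mul, zero_mul]
  refine hnot r'' (mul_left_cancel₀ hx0 ?_)
  rw [← map_mul, ← hr]
  exact congrArg ψ hr''.symm

/-! ### Generators of a variety over its subring of `p`-th powers -/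

section PthPowers

variable {k : Type*} [Field k] [IsAlgClosed k] {p : ℕ} [hp : Fact p.Prime] [CharP k p]

theorem pow_mem_range_algebraMap_pthPowers {A : Type*} [CommRing A] [Nontrivial A] [Algebra k A]
    (a : A) : a ^ p ∈ (algebraMap (pthPowers k p A) A).range :=
  ⟨⟨a ^ p, a, rfl⟩, rfl⟩

theorem finite_pthPowers (k : Type*) [Field k] [IsAlgClosed k] (p : ℕ) [hp : Fact p.Prime]
    [CharP k p] (A : Type*) [CommRing A] [Nontrivial A] [Algebra k A] [Algebra.FiniteType k A] :
    Module.Finite (pthPowers k p A) A := by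
  have : Algebra.FiniteType (pthPowers k p A) A :=
    Algebra.FiniteType.of_restrictScalars_finiteType k _ A
  have : Algebra.IsIntegral (pthPowers k p A) A := ⟨fun a => IsIntegral.of_pow hp.out.pos <| by
    obtain ⟨b, hb⟩ := pow_mem_range_algebraMap_pthPowers (k := k) (p := p) a
    rw [← hb]
    exact isIntegral_algebraMap⟩
  exact Algebra.IsIntegral.finite

theorem cotangentClass_algebraMap {k A : Type*} [Field k] [CommRing A] [Algebra k A]
    (x : A →ₐ[k] k) (c : k) : cotangentClass x (algebraMap k A c) = 0 := by
  change (RingHom.ker x).toCotangent _ = 0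
  rw [Ideal.toCotangent_eq_zero]
  simp

theorem finiteDimensional_cotangent {k A : Type*} [Field k] [CommRing A] [Algebra k A]
    [Algebra.FiniteType k A] (x : A →ₐ[k] k) : FiniteDimensional k (RingHom.ker x).Cotangent := by
  have : IsNoetherianRing A := Algebra.FiniteType.isNoetherianRing k A
  have hfin : Module.Finite A (RingHom.ker x).Cotangent :=
    Module.Finite.of_surjective (RingHom.ker x).toCotangent (RingHom.ker x).toCotangent_surjective
  obtain ⟨S, hS⟩ := hfin.fg_top
  refine ⟨⟨S, ?_⟩⟩
  rw [eq_top_iff]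
  intro v _
  have hv : v ∈ Submodule.span A (S : Set (RingHom.ker x).Cotangent) := hS ▸ Submodule.mem_top
  induction hv using Submodule.span_induction with
  | mem v hv => exact Submodule.subset_span hv
  | zero => exact zero_mem _
  | add v w _ _ hv hw => exact add_mem (hv trivial) (hw trivial)
  | smul a v _ hv =>
    have : a • v = x a • v := by
      obtain ⟨b, rfl⟩ := (RingHom.ker x).toCotangent_surjective v
      rw [← map_smul, ← LinearMap.CompatibleSMul.map_smul, Ideal.toCotangent_eq, pow_two]
      convert Ideal.mul_mem_mul (I := RingHom.ker x) (J := RingHom.ker x)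
        (r := a - algebraMap k A (x a)) (by simp [RingHom.mem_ker]) b.2 using 1
      simp [Algebra.smul_def, sub_mul]
    rw [this]
    exact Submodule.smul_mem _ _ (hv trivial)

theorem exists_sumElim_basis {k V ι : Type*} [Field k] [AddCommGroup V] [Module k V]
    [FiniteDimensional k V] (v : ι → V) (hv : LinearIndependent k v) :
    ∃ (m : ℕ) (w : Fin m → V), LinearIndependent k (Sum.elim v w) ∧
      Submodule.span k (Set.range (Sum.elim v w)) = ⊤ := by
  obtain ⟨W, hW⟩ := Submodule.exists_isCompl (Submodule.span k (Set.range v))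
  let b := Module.finBasis k W
  have hb : Submodule.span k (Set.range fun i => (b i : V)) = W := by
    have : (fun i => (b i : V)) = W.subtype ∘ b := rfl
    rw [this, Set.range_comp, Submodule.span_image, b.span_eq, Submodule.map_subtype_top]
  refine ⟨_, fun i => b i, hv.sum_type ?_ ?_, ?_⟩
  · exact b.linearIndependent.map' W.subtype W.ker_subtype
  · rw [hb]
    exact hW.disjoint
  · rw [Set.Sum.elim_range, Submodule.span_union, hb]
    exact hW.sup_eq_top

theorem exists_sumElim_cotangent_basis {k A ι : Type*} [Field k] [CommRing A] [Algebra k A]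
    [Algebra.FiniteType k A] (x : A →ₐ[k] k) (f : ι → A)
    (hf : LinearIndependent k fun i => cotangentClass x (f i)) :
    ∃ (m : ℕ) (g : Fin m → A), LinearIndependent k (fun i => cotangentClass x (Sum.elim f g i)) ∧
      Submodule.span k (Set.range fun i => cotangentClass x (Sum.elim f g i)) = ⊤ := by
  have := finiteDimensional_cotangent x
  obtain ⟨m, w, h1, h2⟩ := exists_sumElim_basis _ hf
  choose g _ hg using fun i => cotangentClass_surjective x (w i)
  have : (fun i => cotangentClass x (Sum.elim f g i)) =
      Sum.elim (fun i => cotangentClass x (f i)) w := by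
    ext i
    rcases i with i | i
    · rfl
    · exact hg i
  exact ⟨m, g, by rwa [this], by rwa [this]⟩

/-- If the differentials of `h` span the cotangent space at `x`, then `A` is generated by `h` as an
algebra over its subring of `p`-th powers after shrinking to a neighbourhood of `x`. -/
theorem exists_pow_mul_mem_adjoin {A : Type*} [CommRing A] [Nontrivial A] [Algebra k A]
    [Algebra.FiniteType k A] (x : A →ₐ[k] k) {ι : Type*} (h : ι → A)
    (hspan : Submodule.span k (Set.range fun i => cotangentClass x (h i)) = ⊤) :
    ∃ s : A, x s = 1 ∧ ∀ a, s ^ p * a ∈ Algebra.adjoin (pthPowers k p A) (Set.range h) := by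
  have hnoeth : IsNoetherianRing A := Algebra.FiniteType.isNoetherianRing k A
  set C := Algebra.adjoin (pthPowers k p A) (Set.range h) with hC
  let n : Ideal C := (RingHom.ker x).comap (algebraMap C A)
  let J : Ideal A := n.map (algebraMap C A)
  have hCk : ∀ c : k, algebraMap k A c ∈ C := fun c =>
    C.algebraMap_mem (algebraMap k (pthPowers k p A) c)
  have hmemJ : ∀ a ∈ C, x a = 0 → a ∈ J := fun a ha hxa =>
    Ideal.mem_map_of_mem (algebraMap C A) (x := (⟨a, ha⟩ : C)) hxa
  have hJle : J ≤ RingHom.ker x := Ideal.map_comap_le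
  have hspanJ : ∀ v ∈ Submodule.span k (Set.range fun i => cotangentClass x (h i)),
      ∃ b ∈ J, cotangentClass x b = v := by
    intro v hv
    induction hv using Submodule.span_induction with
    | mem v hv =>
      obtain ⟨i, rfl⟩ := hv
      refine ⟨h i - algebraMap k A (x (h i)), hmemJ _ (sub_mem (Algebra.subset_adjoin ⟨i, rfl⟩)
        (hCk _)) (by simp), ?_⟩
      rw [map_sub, cotangentClass_algebraMap, sub_zero]
    | zero => exact ⟨0, zero_mem _, map_zero _⟩
    | add v w _ _ hv hw =>
      obtain ⟨b, hb, rfl⟩ := hv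
      obtain ⟨c, hc, rfl⟩ := hw
      exact ⟨b + c, add_mem hb hc, map_add _ _ _⟩
    | smul r v _ hv =>
      obtain ⟨b, hb, rfl⟩ := hv
      exact ⟨r • b, J.smul_of_tower_mem r hb, map_smul _ _ _⟩
  have hle : RingHom.ker x ≤ J := by
    have hbot : (RingHom.ker x).map (Ideal.Quotient.mk J) = ⊥ := by
      refine Submodule.eq_bot_of_le_smul_of_le_jacobson_bot
        ((RingHom.ker x).map (Ideal.Quotient.mk J)) _ (Ideal.FG.map (hnoeth.noetherian _) _) ?_ ?_
      · rw [smul_eq_mul, ← Ideal.map_mul, Ideal.map_le_iff_le_comap]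
        intro a ha
        obtain ⟨b, hb, hba⟩ := hspanJ (cotangentClass x a) (hspan ▸ Submodule.mem_top)
        have hab : a - b ∈ RingHom.ker x ^ 2 := by
          have h1 : a - b ∈ RingHom.ker x := sub_mem ha (hJle hb)
          rw [← (RingHom.ker x).toCotangent_eq_zero ⟨a - b, h1⟩, ← cotangentClass_of_mem h1,
            map_sub, hba, sub_self]
        rw [pow_two] at hab
        have h2 : Ideal.Quotient.mk J a = Ideal.Quotient.mk J (a - b) := by
          rw [map_sub, Ideal.Quotient.eq_zero_iff_mem.mpr hb, sub_zero]
        rw [Ideal.mem_comap, h2]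
        exact Ideal.mem_map_of_mem _ hab
      · refine le_trans ?_ (Ideal.radical_le_jacobson)
        rw [Ideal.map_le_iff_le_comap]
        intro a ha
        refine ⟨p, ?_⟩
        rw [← map_pow, Ideal.mem_bot, Ideal.Quotient.eq_zero_iff_mem]
        refine hmemJ _ (C.algebraMap_mem (⟨a ^ p, a, rfl⟩ : pthPowers k p A)) ?_
        rw [map_pow, (RingHom.mem_ker).mp ha, zero_pow hp.out.ne_zero]
    intro a ha
    rw [← Ideal.Quotient.eq_zero_iff_mem, ← Ideal.mem_bot, ← hbot]
    exact Ideal.mem_map_of_mem _ ha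
  have := finite_pthPowers k p A
  have : Module.Finite C A := Module.Finite.of_restrictScalars_finite (pthPowers k p A) C A
  let N : Submodule C A := LinearMap.range (Algebra.linearMap C A)
  have hN : ∀ a, a ∈ N ↔ a ∈ C := fun a =>
    ⟨by rintro ⟨c, rfl⟩; exact c.2, fun ha => ⟨⟨a, ha⟩, rfl⟩⟩
  obtain ⟨r, hr, hr'⟩ := Submodule.exists_sub_one_mem_and_smul_eq_zero_of_fg_of_le_smul n
    (⊤ : Submodule C (A ⧸ N)) Module.Finite.fg_top <| by
      intro v _
      obtain ⟨a, rfl⟩ := N.mkQ_surjective v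
      have h1 : N.mkQ a = N.mkQ (a - algebraMap k A (x a)) := by
        rw [← sub_eq_zero, ← map_sub, Submodule.mkQ_apply, Submodule.Quotient.mk_eq_zero, hN,
          sub_sub_cancel]
        exact hCk _
      have h2 : a - algebraMap k A (x a) ∈ n • (⊤ : Submodule C A) := by
        rw [Ideal.smul_top_eq_map]
        exact hle (by simp [RingHom.mem_ker])
      have h3 := Submodule.mem_map_of_mem (f := N.mkQ) h2
      rw [Submodule.map_smul'', ← h1] at h3
      exact Submodule.smul_mono le_rfl le_top h3
  refine ⟨r, ?_, fun a => ?_⟩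
  · have : x ((r : A) - 1) = 0 := hr
    rwa [map_sub, map_one, sub_eq_zero] at this
  · have h1 := hr' (N.mkQ a) trivial
    rw [← map_smul, Submodule.mkQ_apply, Submodule.Quotient.mk_eq_zero, hN] at h1
    obtain ⟨m, hm⟩ := Nat.exists_eq_succ_of_ne_zero hp.out.ne_zero
    have h2 : (r : A) ^ p * a = (r : A) ^ m * (r • a) := by
      rw [Algebra.smul_def, ← mul_assoc]
      congr 1
      exact (congrArg _ hm).trans (pow_succ _ _)
    rw [h2]
    exact mul_mem (pow_mem r.2 m) h1

theorem exists_pow_mul_eq_sum {A : Type*} [CommRing A] [Nontrivial A] [Algebra k A]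
    [Algebra.FiniteType k A] (x : A →ₐ[k] k) {ι : Type*} [Fintype ι] [DecidableEq ι] (h : ι → A)
    (hspan : Submodule.span k (Set.range fun i => cotangentClass x (h i)) = ⊤) :
    ∃ s : A, x s = 1 ∧ ∀ a, ∃ c : (ι → Fin p) → A,
      s ^ p * a = ∑ γ, c γ ^ p * redMonomial h γ := by
  obtain ⟨s, hs, hsa⟩ := exists_pow_mul_mem_adjoin (p := p) x h hspan
  refine ⟨s, hs, fun a => ?_⟩
  have h1 := hsa a
  rw [← Subalgebra.mem_toSubmodule,
    ← span_redMonomial_eq_adjoin h fun i => pow_mem_range_algebraMap_pthPowers (h i),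
    Submodule.mem_span_range_iff_exists_fun] at h1
  obtain ⟨c, hc⟩ := h1
  choose d hd using fun γ => (c γ).2
  refine ⟨d, ?_⟩
  rw [← hc]
  refine Finset.sum_congr rfl fun γ _ => ?_
  rw [hd]
  rfl

/-- At a smooth point where the differentials of `f` are linearly independent, the coefficients of
a regular function with respect to the reduced monomials in `f` are regular. -/
theorem exists_smul_coeff_mem_range {A : Type*} [CommRing A] [IsDomain A] [Algebra k A]
    [Algebra.FiniteType k A] (K : Type*) [Field K] [Algebra A K] [IsFractionRing A K] [Algebra k K]
    [IsScalarTower k A K] (x : A →ₐ[k] k)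
    [Algebra.FormallySmooth k (Localization.AtPrime (RingHom.ker x))] {ι : Type*} [Fintype ι]
    [DecidableEq ι] (f : ι → A) (hf : LinearIndependent k fun i => cotangentClass x (f i))
    (β : (ι → Fin p) → K) (a : A)
    (ha : algebraMap A K a = ∑ α, β α ^ p * redMonomial (fun i => algebraMap A K (f i)) α)
    (α : ι → Fin p) : ∃ s : A, x s ≠ 0 ∧ s • β α ∈ (algebraMap A K).range := by
  have hchar : CharP K p := charP_of_injective_algebraMap (algebraMap k K).injective p
  obtain ⟨m, g, hli, hspan⟩ := exists_sumElim_cotangent_basis x f hf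
  obtain ⟨s, hs, hsa⟩ := exists_pow_mul_eq_sum (p := p) x _ hspan
  refine ⟨s, by simp [hs], ?_⟩
  obtain ⟨c, hc⟩ := hsa a
  have hLI := linearIndependent_redMonomial_pthPowersField (p := p) K x _ hli
  let e : (ι → Fin p) → (ι ⊕ Fin m → Fin p) := fun α => Sum.elim α fun _ => ⟨0, hp.out.pos⟩
  have he : Function.Injective e := fun α β hαβ => funext fun i => congrFun hαβ (Sum.inl i)
  let B : (ι ⊕ Fin m → Fin p) → K := Function.extend e (fun α => algebraMap A K s * β α) 0
  have hB : ∀ α, B (e α) = algebraMap A K s * β α := fun α => he.extend_apply _ _ α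
  have hsum : ∑ γ, (⟨algebraMap A K (c γ) ^ p, _, rfl⟩ : pthPowersField k p K) •
        redMonomial (fun i => algebraMap A K (Sum.elim f g i)) γ =
      ∑ γ, (⟨B γ ^ p, _, rfl⟩ : pthPowersField k p K) •
        redMonomial (fun i => algebraMap A K (Sum.elim f g i)) γ := by
    have h1 := congrArg (algebraMap A K) hc
    rw [map_sum, map_mul, ha, Finset.mul_sum] at h1
    refine Eq.trans ?_ (h1.symm.trans ?_)
    · refine Finset.sum_congr rfl fun γ _ => ?_
      rw [map_mul, map_pow, map_redMonomial]
      rfl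
    · refine Fintype.sum_of_injective e he _ _ ?_ ?_
      · intro γ hγ
        have : B γ = 0 := Function.extend_apply' _ _ _ hγ
        change B γ ^ p * _ = 0
        rw [this, zero_pow hp.out.ne_zero, zero_mul]
      · intro α
        change _ = B (e α) ^ p * redMonomial _ (e α)
        rw [hB, mul_pow, map_pow, mul_assoc]
        congr 2
        simp [redMonomial, e, Fintype.prod_sum_type]
  have h2 := Fintype.linearIndependent_iffₛ.mp hLI _ _ hsum (e α)
  have h3 : algebraMap A K (c (e α)) ^ p = B (e α) ^ p := Subtype.ext_iff.mp h2
  rw [hB] at h3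
  refine ⟨c (e α), ?_⟩
  rw [Algebra.smul_def]
  exact frobenius_inj K p h3

end PthPowers

/-! ### Rational points of affine varieties -/

theorem exists_algHom_ker_eq {k A : Type*} [Field k] [IsAlgClosed k] [CommRing A] [Algebra k A]
    [Algebra.FiniteType k A] (M : Ideal A) [hM : M.IsMaximal] :
    ∃ x : A →ₐ[k] k, RingHom.ker x = M := by
  let : Field (A ⧸ M) := Ideal.Quotient.field M
  have : Module.Finite k (A ⧸ M) := finite_of_finite_type_of_isJacobsonRing k (A ⧸ M)
  let e : k ≃ₐ[k] A ⧸ M := AlgEquiv.ofBijective (Algebra.ofId k (A ⧸ M))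
    IsAlgClosed.algebraMap_bijective_of_isIntegral
  refine ⟨e.symm.toAlgHom.comp (Ideal.Quotient.mkₐ k M), ?_⟩
  ext a
  rw [RingHom.mem_ker, ← Ideal.Quotient.eq_zero_iff_mem]
  exact map_eq_zero_iff e.symm e.symm.injective

theorem le_of_forall_algHom {k A : Type*} [Field k] [IsAlgClosed k] [CommRing A] [Algebra k A]
    [Algebra.FiniteType k A] (I P : Ideal A) [hP : P.IsPrime]
    (h : ∀ x : A →ₐ[k] k, P ≤ RingHom.ker x → I ≤ RingHom.ker x) : I ≤ P := by
  have : IsJacobsonRing A := isJacobsonRing_of_finiteType (A := k)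
  rw [← isJacobsonRing_iff_prime_eq.mp this P hP]
  refine le_sInf fun M ⟨hPM, hM⟩ => ?_
  obtain ⟨x, rfl⟩ := exists_algHom_ker_eq (k := k) M
  exact h x hPM

/-- A rational function on a smooth affine variety which is regular outside of a subset of
codimension at least two is regular. -/
theorem mem_range_algebraMap_of_two_le_codimension {k A : Type*} [Field k] [IsAlgClosed k]
    [CommRing A] [IsDomain A] [Algebra k A] [Algebra.Smooth k A] (K : Type*) [Field K]
    [Algebra A K] [IsFractionRing A K] (Z : Set (A →ₐ[k] k)) (hZ : 2 ≤ codimension Z) (b : K)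
    (h : ∀ x ∉ Z, ∃ s : A, x s ≠ 0 ∧ s • b ∈ (algebraMap A K).range) :
    b ∈ (algebraMap A K).range := by
  refine mem_range_algebraMap_of_two_le_height k K b fun P hP hb => hZ.trans ?_
  refine Ideal.height_mono (le_of_forall_algHom (k := k) _ P fun x hx => ?_)
  refine iInf₂_le x ?_
  by_contra hxZ
  obtain ⟨s, hs, hsb⟩ := h x hxZ
  exact hs (hx (hb s hsb))

instance formallySmooth_localization_ker {k A : Type*} [Field k] [CommRing A] [Algebra k A]
    [Algebra.Smooth k A] (x : A →ₐ[k] k) :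
    Algebra.FormallySmooth k (Localization.AtPrime (RingHom.ker x)) := by
  have : (⟨RingHom.ker x, RingHom.ker_isPrime x⟩ : PrimeSpectrum A) ∈ Algebra.smoothLocus k A := by
    rw [Algebra.smoothLocus_eq_univ]
    trivial
  exact this

section Invariants

variable {k : Type*} [Field k] [IsAlgClosed k] {p : ℕ} [hp : Fact p.Prime] [CharP k p]

theorem LinearIndependent.redMonomial_of_map {F R K ι : Type*} [Fintype ι] [DecidableEq ι]
    [CommRing F] [CommRing R] [Algebra F R] [Field K] [Algebra k K] (ψ : R →+* K) (b : ι → R)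
    (h : LinearIndependent (pthPowersField k p K) (redMonomial (p := p) fun i => ψ (b i)))
    (hF : ∀ c : F, ∃ a : K, a ^ p = ψ (algebraMap F R c))
    (hinj : Function.Injective (ψ.comp (algebraMap F R))) :
    LinearIndependent F (redMonomial (p := p) b) := by
  rw [Fintype.linearIndependent_iff] at h ⊢
  intro c hc α
  have h1 := h (fun α => ⟨ψ (algebraMap F R (c α)), hF (c α)⟩) (by
    rw [← map_zero ψ, ← hc, map_sum]
    refine Finset.sum_congr rfl fun α _ => ?_
    rw [Algebra.smul_def (A := R), map_mul ψ, map_redMonomial]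
    rfl) α
  have h2 : ψ (algebraMap F R (c α)) = 0 := Subtype.ext_iff.mp h1
  exact (injective_iff_map_eq_zero _).mp hinj _ h2

namespace PLieAction

variable {𝔤 A : Type*} [LieRing 𝔤] [LieAlgebra k 𝔤] [PLieAlgebra k p 𝔤] [CommRing A] [IsDomain A]
  [Algebra k A] (K : Type*) [Field K] [Algebra A K] [IsFractionRing A K] [Algebra k K]

theorem invariants_eq_adjoin [Algebra.Smooth k A] [IsScalarTower k A K]
    (act : PLieAction k p 𝔤 A) {n : ℕ} (f : Fin n → A)
    (hf : ∀ i, f i ∈ act.invariants)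
    (hK : act.invariantField K = (IntermediateField.adjoin (pthPowersField k p K)
      (Set.range fun i => algebraMap A K (f i))).restrictScalars k)
    (hU : 2 ≤ codimension (independenceLocus k f)ᶜ) :
    act.invariants = (Algebra.adjoin (pthPowers k p A) (Set.range f)).restrictScalars k := by
  have hint : ∀ i, algebraMap A K (f i) ^ p ∈ (algebraMap (pthPowersField k p K) K).range :=
    fun i => pow_mem_range_algebraMap_pthPowersField _
  apply le_antisymm
  · intro a ha
    have h1 : algebraMap A K a ∈ act.invariantField K :=
      (act.algebraMap_mem_invariantField_iff K a).mpr ha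
    have h2 : algebraMap A K a ∈ Submodule.span (pthPowersField k p K)
        (Set.range (redMonomial (p := p) fun i => algebraMap A K (f i))) := by
      rw [span_redMonomial_eq_adjoin _ hint, ← IntermediateField.adjoin_toSubalgebra_of_isAlgebraic]
      · rw [hK] at h1
        exact h1
      · rintro _ ⟨i, rfl⟩
        refine IsIntegral.isAlgebraic (IsIntegral.of_pow hp.out.pos ?_)
        obtain ⟨b, hb⟩ := hint i
        rw [← hb]
        exact isIntegral_algebraMap
    obtain ⟨c, hc⟩ := (Submodule.mem_span_range_iff_exists_fun _).mp h2
    choose β hβ using fun α => (c α).2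
    have h3 : algebraMap A K a =
        ∑ α, β α ^ p * redMonomial (fun i => algebraMap A K (f i)) α := by
      rw [← hc]
      refine Finset.sum_congr rfl fun α _ => ?_
      rw [hβ]
      rfl
    have h4 : ∀ α, ∃ b, algebraMap A K b = β α := fun α =>
      mem_range_algebraMap_of_two_le_codimension K _ hU (β α) fun x hx =>
        exists_smul_coeff_mem_range (p := p) K x f
          ((linearIndependent_differentialAt_iff x f).mp (not_not.mp hx)) β a h3 α
    choose b hb using h4
    have h5 : a = ∑ α, b α ^ p * redMonomial f α := by
      apply IsFractionRing.injective A K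
      rw [h3, map_sum]
      refine Finset.sum_congr rfl fun α _ => ?_
      rw [map_mul, map_pow, hb, map_redMonomial]
    rw [Subalgebra.mem_restrictScalars, h5]
    refine sum_mem fun α _ => mul_mem ?_ (redMonomial_mem_adjoin f α)
    exact Subalgebra.algebraMap_mem _ (⟨b α ^ p, b α, rfl⟩ : pthPowers k p A)
  · intro a ha
    rw [Subalgebra.mem_restrictScalars] at ha
    induction ha using Algebra.adjoin_induction with
    | mem x hx =>
      obtain ⟨i, rfl⟩ := hx
      exact hf i
    | algebraMap r => exact act.pthPowers_le_invariants r.2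
    | add x y _ _ hx hy => exact add_mem hx hy
    | mul x y _ _ hx hy => exact mul_mem hx hy

theorem linearIndependent_redMonomial_invariants (act : PLieAction k p 𝔤 A) {n : ℕ}
    (f : Fin n → act.invariants)
    (hli : LinearIndependent (pthPowersField k p K)
      (redMonomial (p := p) fun i => algebraMap A K (f i))) :
    LinearIndependent (pthPowers k p A) (redMonomial (p := p) f) := by
  refine LinearIndependent.redMonomial_of_map (k := k)
    ((algebraMap A K).comp act.invariants.val.toRingHom) f hli ?_ ?_
  · rintro ⟨_, a, rfl⟩
    exact ⟨algebraMap A K a, (map_pow _ _ _).symm⟩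
  · exact (IsFractionRing.injective A K).comp Subtype.val_injective

theorem span_redMonomial_invariants (act : PLieAction k p 𝔤 A) {n : ℕ}
    (f : Fin n → act.invariants)
    (h : act.invariants =
      (Algebra.adjoin (pthPowers k p A) (Set.range fun i => (f i : A))).restrictScalars k) :
    Submodule.span (pthPowers k p A) (Set.range (redMonomial (p := p) f)) = ⊤ := by
  rw [eq_top_iff]
  rintro ⟨a, ha⟩ -
  have ha' : a ∈ Algebra.adjoin (pthPowers k p A) (Set.range fun i => (f i : A)) := by
    rw [h] at ha
    exact ha
  rw [← Subalgebra.mem_toSubmodule, ← span_redMonomial_eq_adjoin _ fun i =>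
    pow_mem_range_algebraMap_pthPowers (f i : A), Submodule.mem_span_range_iff_exists_fun] at ha'
  rw [Submodule.mem_span_range_iff_exists_fun]
  obtain ⟨c, hc⟩ := ha'
  refine ⟨c, Subtype.ext ?_⟩
  change _ = a
  rw [← hc, ← Subalgebra.val_apply, map_sum]
  refine Finset.sum_congr rfl fun α _ => ?_
  rw [Algebra.smul_def, map_mul]
  exact congrArg _ (map_redMonomial act.invariants.val.toRingHom f α)

end PLieAction

end Invariants

universe u

/-! ### Complete intersections -/

theorem RingHom.Flat.isWeaklyRegular_map {R S : Type*} [CommRing R] [CommRing S] {θ : R →+* S}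
    (hθ : θ.Flat) {rs : List R} (h : RingTheory.Sequence.IsWeaklyRegular R rs) :
    RingTheory.Sequence.IsWeaklyRegular S (rs.map θ) := by
  algebraize [θ]
  exact h.of_flat

/-- A ring generated by elements with dual derivations whose `p`-th powers are constants is flat
over the constants. -/
theorem RingHom.flat_of_dual_derivation {p : ℕ} [hp : Fact p.Prime] {ι F S : Type*} [Fintype ι]
    [DecidableEq ι] [CommRing F] [IsDomain F] [CharP F p] [CommRing S] (θ : F →+* S)
    (hinj : Function.Injective θ) (b : ι → S) (D : ι → Derivation ℤ S S)
    (hD : ∀ i j, D i (b j) = if i = j then 1 else 0) (hθ : ∀ i a, D i (θ a) = 0)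
    (hpow : ∀ i, b i ^ p ∈ θ.range)
    (hgen : ∀ T : Subring S, (∀ a, θ a ∈ T) → (∀ i, b i ∈ T) → T = ⊤) : θ.Flat := by
  algebraize [θ]
  have hli : LinearIndependent F (redMonomial (p := p) b) :=
    linearIndependent_redMonomial_of_derivation hinj b (fun i => (D i).extendBase (hθ i)) hD
  have hspan : Submodule.span F (Set.range (redMonomial (p := p) b)) = ⊤ := by
    rw [span_redMonomial_eq_adjoin b hpow, Algebra.toSubmodule_eq_top, ← Subalgebra.toSubring_inj,
      Algebra.top_toSubring]
    exact hgen _ (fun a => Subalgebra.algebraMap_mem _ a)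
      fun i => Algebra.subset_adjoin (Set.mem_range_self i)
  have := Module.Free.of_basis (Module.Basis.mk hli hspan.ge)
  exact RingHom.flat_algebraMap_iff.mpr inferInstance

theorem MvPolynomial.isWeaklyRegular_X {F : Type*} [CommRing F] (n : ℕ) :
    RingTheory.Sequence.IsWeaklyRegular (MvPolynomial (Fin n) F)
      (List.ofFn fun i => (X i : MvPolynomial (Fin n) F)) := by
  classical
  rw [RingTheory.Sequence.isWeaklyRegular_iff]
  intro i hi
  have hin : i < n := by simpa using hi
  have hlist : Ideal.ofList ((List.ofFn fun i => (X i : MvPolynomial (Fin n) F)).take i) =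
      Ideal.span (X '' {j : Fin n | (j : ℕ) < i}) := by
    refine congrArg Ideal.span (Set.ext fun r => ?_)
    simp only [List.mem_take_iff_getElem, Set.mem_ofPred_eq, Set.mem_image]
    constructor
    · rintro ⟨j, hj, rfl⟩
      exact ⟨⟨j, by simp at hj; omega⟩, by simp at hj; simp; omega, by simp⟩
    · rintro ⟨j, hj, rfl⟩
      exact ⟨j, by simp; omega, by simp⟩
  rw [hlist]
  refine (isSMulRegular_quotient_iff_mem_of_smul_mem _ _).mpr fun P hP => ?_
  rw [smul_eq_mul, Ideal.mul_top, mem_ideal_span_X_image] at hP ⊢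
  intro m hm
  have hX : (List.ofFn fun i => (X i : MvPolynomial (Fin n) F))[i] = X ⟨i, hin⟩ := by simp
  obtain ⟨j, hj, hmj⟩ := hP (Finsupp.single ⟨i, hin⟩ 1 + m) <| by
    rw [mem_support_iff, hX, smul_eq_mul, coeff_X_mul]
    exact mem_support_iff.mp hm
  refine ⟨j, hj, ?_⟩
  have hne : (⟨i, hin⟩ : Fin n) ≠ j := by
    rintro rfl
    exact lt_irrefl i hj
  simpa [Finsupp.single_apply, hne] using hmj

theorem MvPolynomial.flat_aeval_X_pow_sub_C {p : ℕ} [hp : Fact p.Prime] {F : Type*} [CommRing F]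
    [IsDomain F] [CharP F p] {ι : Type*} [Fintype ι] [DecidableEq ι] (c : ι → F) :
    (aeval fun i => X i ^ p - C (c i) :
      MvPolynomial ι F →ₐ[F] MvPolynomial ι F).toRingHom.Flat := by
  refine RingHom.flat_of_dual_derivation (p := p) _ ?_ X
    (fun i => (pderiv i).restrictScalars ℤ) ?_ ?_ ?_ ?_
  · let σ : MvPolynomial ι F →ₐ[F] MvPolynomial ι F := aeval fun i => X i - C (c i)
    let τ : MvPolynomial ι F →ₐ[F] MvPolynomial ι F := aeval fun i => X i + C (c i)
    have hτ : τ.comp σ = AlgHom.id F _ := by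
      ext i
      simp [σ, τ]
    have hσ : Function.Injective σ :=
      Function.LeftInverse.injective (g := τ) fun P => DFunLike.congr_fun hτ P
    have h : (aeval fun i => X i ^ p - C (c i) : MvPolynomial ι F →ₐ[F] MvPolynomial ι F) =
        (expand p).comp σ := by
      ext i
      simp [σ]
    rw [h]
    exact (expand_injective hp.out.pos).comp hσ
  · intro i j
    simp [pderiv_X, Pi.single_apply, eq_comm]
  · intro i P
    change pderiv i (aeval _ P) = 0
    rw [(pderiv i).apply_aeval_mvPolynomial]
    refine Finset.sum_eq_zero fun j _ => ?_
    simp [Derivation.leibniz_pow]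
  · intro i
    refine ⟨X i + C (c i), ?_⟩
    simp
  · intro T hT hX
    rw [eq_top_iff]
    rintro P -
    induction P using MvPolynomial.induction_on with
    | C a => simpa using hT (C a)
    | add P Q hP hQ => exact add_mem hP hQ
    | mul_X P i hP => exact mul_mem hP (hX i)

theorem MvPolynomial.isWeaklyRegular_X_pow_sub_C {p : ℕ} [Fact p.Prime] {F : Type*} [CommRing F]
    [IsDomain F] [CharP F p] {n : ℕ} (c : Fin n → F) :
    RingTheory.Sequence.IsWeaklyRegular (MvPolynomial (Fin n) F)
      (List.ofFn fun i => X i ^ p - C (c i)) := by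
  have h := (flat_aeval_X_pow_sub_C (p := p) c).isWeaklyRegular_map (isWeaklyRegular_X n)
  rw [List.map_ofFn] at h
  have h' : ((aeval fun i => X i ^ p - C (c i) :
      MvPolynomial (Fin n) F →ₐ[F] MvPolynomial (Fin n) F).toRingHom ∘ fun i => X i) =
      fun i => X i ^ p - C (c i) := _root_.funext fun i => aeval_X _ i
  rwa [h'] at h

/-- A quotient of a regular ring by a weakly regular sequence is a locally complete
intersection. -/
theorem isLocallyCompleteIntersection_of_surjective {R B : Type u} [CommRing R] [IsRegularRing R]
    [CommRing B] (π : R →+* B) (hπ : Function.Surjective π) (rs : List R)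
    (hrs : RingTheory.Sequence.IsWeaklyRegular R rs) (hker : RingHom.ker π = Ideal.ofList rs) :
    IsLocallyCompleteIntersection B := by
  refine ⟨isNoetherianRing_of_surjective R B π hπ, fun q _ => ?_⟩
  let Q := q.comap π
  have hmap : Submonoid.map π Q.primeCompl = q.primeCompl := by
    ext b
    constructor
    · rintro ⟨a, ha, rfl⟩
      exact ha
    · intro hb
      obtain ⟨a, rfl⟩ := hπ b
      exact ⟨a, hb, rfl⟩
  refine ⟨Localization.AtPrime Q, inferInstance,
    IsRegularRing.isRegularLocalRing_localization Q,
    rs.map (algebraMap R (Localization.AtPrime Q)), ?_, ?_⟩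
  · refine hrs.isRegular_of_isLocalization_of_mem (p := Q) _ fun r hr => ?_
    have : r ∈ RingHom.ker π := hker ▸ Ideal.subset_span hr
    change π r ∈ q
    rw [(RingHom.mem_ker).mp this]
    exact zero_mem q
  · have hle : Q.primeCompl ≤ Submonoid.comap π q.primeCompl :=
      Submonoid.map_le_iff_le_comap.mp hmap.le
    have hk := IsLocalization.ker_map (S := Localization.AtPrime Q) (Localization.AtPrime q)
      (M := Q.primeCompl) (T := q.primeCompl) (g := π) hmap
    have hs : Function.Surjective (IsLocalization.map (S := Localization.AtPrime Q)
        (M := Q.primeCompl) (Localization.AtPrime q) π hle) := by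
      intro b
      obtain ⟨b, s, rfl⟩ := IsLocalization.exists_mk'_eq q.primeCompl b
      obtain ⟨b, rfl⟩ := hπ b
      obtain ⟨s, hs⟩ := s
      rw [← hmap] at hs
      obtain ⟨s, hs, rfl⟩ := hs
      exact ⟨IsLocalization.mk' _ b ⟨s, hs⟩, by rw [IsLocalization.map_mk']⟩
    rw [hker, Ideal.map_ofList] at hk
    exact ⟨(Ideal.quotEquivOfEq hk.symm).trans (RingHom.quotientKerEquivOfSurjective hs)⟩

theorem isLocallyCompleteIntersection_of_redMonomial {p : ℕ} [Fact p.Prime] {F B : Type u}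
    [CommRing F] [IsDomain F] [CharP F p] [IsRegularRing F] [CommRing B] [Algebra F B] {n : ℕ}
    (b : Fin n → B) (hb : ∀ i, b i ^ p ∈ (algebraMap F B).range)
    (hli : LinearIndependent F (redMonomial (p := p) b))
    (hspan : Submodule.span F (Set.range (redMonomial (p := p) b)) = ⊤) :
    IsLocallyCompleteIntersection B := by
  choose c hc using hb
  refine isLocallyCompleteIntersection_of_surjective
    (MvPolynomial.aeval b : MvPolynomial (Fin n) F →ₐ[F] B).toRingHom ?_ _
    (MvPolynomial.isWeaklyRegular_X_pow_sub_C (p := p) c) ?_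
  · rw [span_redMonomial_eq_adjoin b fun i => ⟨c i, hc i⟩, Algebra.toSubmodule_eq_top,
      Algebra.adjoin_range_eq_range_aeval] at hspan
    exact AlgHom.range_eq_top _ |>.mp hspan
  · refine (ker_aeval_eq_span b c hc hli).trans (congrArg Ideal.span ?_)
    ext r
    simp [List.mem_ofFn]

theorem PLieAction.isLocallyCompleteIntersection_invariants {k : Type*} [Field k] [IsAlgClosed k]
    {p : ℕ} [hp : Fact p.Prime] [CharP k p] {𝔤 : Type*} {A : Type u} [LieRing 𝔤] [LieAlgebra k 𝔤]
    [PLieAlgebra k p 𝔤] [CommRing A] [IsDomain A] [Algebra k A] [Algebra.Smooth k A]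
    (act : PLieAction k p 𝔤 A) {n : ℕ} (f : Fin n → act.invariants)
    (hli : LinearIndependent (pthPowers k p A) (redMonomial (p := p) f))
    (hspan : Submodule.span (pthPowers k p A) (Set.range (redMonomial (p := p) f)) = ⊤) :
    IsLocallyCompleteIntersection act.invariants := by
  have : IsRegularRing A := isRegularRing_of_smooth k A
  have : IsRegularRing (pthPowers k p A) := IsRegularRing.of_ringEquiv (equivPthPowers k p A)
  have : CharP (pthPowers k p A) p :=
    charP_of_injective_algebraMap (algebraMap k (pthPowers k p A)).injective p
  exact isLocallyCompleteIntersection_of_redMonomial f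
    (fun i => ⟨⟨(f i : A) ^ p, f i, rfl⟩, Subtype.ext rfl⟩) hli hspan

/-! ### Point derivations of the ring of invariants -/

section PthPowers

variable {k : Type*} [Field k] [IsAlgClosed k] {p : ℕ} [hp : Fact p.Prime] [CharP k p]

/-- If the differentials of `h` span the cotangent space at some point, then the reduced monomials
in `h` span the function field over its subfield of `p`-th powers. -/
theorem span_redMonomial_eq_top_of_cotangentClass {A : Type*} [CommRing A] [IsDomain A]
    [Algebra k A] [Algebra.FiniteType k A] (K : Type*) [Field K] [Algebra A K] [IsFractionRing A K]
    [Algebra k K] (x : A →ₐ[k] k) {ι : Type*} [Fintype ι] [DecidableEq ι] (h : ι → A)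
    (hspan : Submodule.span k (Set.range fun i => cotangentClass x (h i)) = ⊤) :
    Submodule.span (pthPowersField k p K)
      (Set.range (redMonomial (p := p) fun i => algebraMap A K (h i))) = ⊤ := by
  obtain ⟨s, hs, hsa⟩ := exists_pow_mul_eq_sum (p := p) x h hspan
  rw [eq_top_iff]
  rintro z -
  obtain ⟨a, t, ht, rfl⟩ := IsFractionRing.div_surjective (A := A) z
  obtain ⟨c, hc⟩ := hsa (a * t ^ (p - 1))
  have ht0 : algebraMap A K t ≠ 0 := IsFractionRing.to_map_ne_zero_of_mem_nonZeroDivisors ht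
  have hs0 : algebraMap A K s ≠ 0 := by
    rw [Ne, map_eq_zero_iff _ (IsFractionRing.injective A K)]
    rintro rfl
    simp at hs
  have h1 : algebraMap A K a / algebraMap A K t =
      ∑ γ, (⟨(algebraMap A K (c γ) / (algebraMap A K s * algebraMap A K t)) ^ p, _, rfl⟩ :
        pthPowersField k p K) • redMonomial (fun i => algebraMap A K (h i)) γ := by
    have h2 : algebraMap A K a / algebraMap A K t =
        algebraMap A K (s ^ p * (a * t ^ (p - 1))) /
          (algebraMap A K s * algebraMap A K t) ^ p := by
      have h3 : algebraMap A K t ^ p = algebraMap A K t ^ (p - 1) * algebraMap A K t := by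
        rw [← pow_succ, Nat.sub_add_cancel hp.out.one_le]
      rw [map_mul, map_mul, map_pow, map_pow, mul_pow, h3]
      field_simp
    rw [h2, hc, map_sum, Finset.sum_div]
    refine Finset.sum_congr rfl fun γ _ => ?_
    rw [map_mul, map_pow, map_redMonomial, mul_div_right_comm, ← div_pow]
    rfl
  rw [h1]
  exact sum_mem fun γ _ => Submodule.smul_mem _ _ (Submodule.subset_span ⟨γ, rfl⟩)

theorem finiteDimensional_and_finrank_le_of_cotangentClass {A : Type*} [CommRing A] [IsDomain A]
    [Algebra k A] [Algebra.FiniteType k A] (K : Type*) [Field K] [Algebra A K] [IsFractionRing A K]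
    [Algebra k K] (x : A →ₐ[k] k) {ι : Type*} [Fintype ι] [DecidableEq ι] (h : ι → A)
    (hspan : Submodule.span k (Set.range fun i => cotangentClass x (h i)) = ⊤) :
    FiniteDimensional (pthPowersField k p K) K ∧
      Module.finrank (pthPowersField k p K) K ≤ p ^ Fintype.card ι := by
  have h0 := span_redMonomial_eq_top_of_cotangentClass (p := p) K x h hspan
  refine ⟨⟨⟨(Set.finite_range (redMonomial (p := p) fun i => algebraMap A K (h i))).toFinset,
    by simpa using h0⟩⟩, ?_⟩
  have h1 := finrank_range_le_card (R := pthPowersField k p K)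
    (redMonomial (p := p) fun i => algebraMap A K (h i))
  rw [Set.finrank, h0, finrank_top] at h1
  simpa using h1

/-- The point derivation `a ^ p ↦ (δ a) ^ p` of the subring of `p`-th powers. -/
theorem IsPointDerivation.exists_pthPowers {A : Type*} [CommRing A] [IsDomain A] [Algebra k A]
    {x : A →ₐ[k] k} {δ : A →ₗ[k] k} (hδ : IsPointDerivation x δ) :
    ∃ d : pthPowers k p A →ₗ[k] k, IsPointDerivation (x.comp (pthPowers k p A).val) d ∧
      ∀ a, d (equivPthPowers k p A a) = δ a ^ p := by
  let e := equivPthPowers k p A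
  let d : pthPowers k p A →ₗ[k] k :=
    { toFun := fun u => δ (e.symm u) ^ p
      map_add' := fun u v => by rw [map_add, map_add, add_pow_char]
      map_smul' := fun c u => by
        obtain ⟨b, rfl⟩ := IsAlgClosed.exists_pow_nat_eq c hp.out.pos
        obtain ⟨a, rfl⟩ := e.surjective u
        have h : b ^ p • e a = e (b • a) := Subtype.ext (smul_pow b a p).symm
        rw [h, e.symm_apply_apply, e.symm_apply_apply, map_smul, smul_eq_mul, mul_pow,
          RingHom.id_apply, smul_eq_mul] }
  have hd : ∀ a, d (e a) = δ a ^ p := fun a => by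
    change δ (e.symm (e a)) ^ p = _
    rw [e.symm_apply_apply]
  refine ⟨d, fun u v => ?_, hd⟩
  obtain ⟨a, rfl⟩ := e.surjective u
  obtain ⟨b, rfl⟩ := e.surjective v
  have hx : ∀ a, (x.comp (pthPowers k p A).val) (e a) = x a ^ p := fun a => map_pow x a p
  rw [← map_mul, hd, hd, hd, hδ, add_pow_char, hx, hx, mul_pow, mul_pow]

/-- Extension of point derivations to a ring generated by `p`-th roots. -/
theorem IsPointDerivation.exists_extension {k : Type*} [Field k] {p : ℕ} [Fact p.Prime]
    [CharP k p] {F B : Type*} [CommRing F] [Algebra k F] [CommRing B]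
    [Algebra k B] [Algebra F B] [IsScalarTower k F B] {ι : Type*} [Fintype ι] (b : ι → B)
    (c : ι → F) (hc : ∀ i, algebraMap F B (c i) = b i ^ p)
    (hli : LinearIndependent F (redMonomial (p := p) b))
    (hspan : Submodule.span F (Set.range (redMonomial (p := p) b)) = ⊤)
    (y : B →ₐ[k] k) (d : F →ₗ[k] k)
    (hd : IsPointDerivation (y.comp (IsScalarTower.toAlgHom k F B)) d) (hdc : ∀ i, d (c i) = 0)
    (u : ι → k) :
    ∃ δ : B →ₗ[k] k, IsPointDerivation y δ ∧ (∀ a, δ (algebraMap F B a) = d a) ∧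
      ∀ i, δ (b i) = u i := by
  set z := y.comp (IsScalarTower.toAlgHom k F B)
  let φ₀ : F →ₐ[k] DualNumber k := AlgHom.ofLinearMap
    { toFun := fun a => TrivSqZeroExt.inl (z a) + TrivSqZeroExt.inr (d a)
      map_add' := fun a b => by ext <;> simp
      map_smul' := fun r a => by ext <;> simp }
    (by
      have h1 := hd.map_algebraMap 1
      rw [map_one] at h1
      ext <;> simp [h1])
    (fun a b => by
      ext
      · simp
      · simp [hd a b, mul_comm])
  let Φ : MvPolynomial ι F →+* DualNumber k := MvPolynomial.eval₂Hom φ₀.toRingHom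
    fun i => TrivSqZeroExt.inl (y (b i)) + TrivSqZeroExt.inr (u i)
  let π := (MvPolynomial.aeval b : MvPolynomial ι F →ₐ[F] B).toRingHom
  have hπ : Function.Surjective π := by
    rw [span_redMonomial_eq_adjoin b fun i => ⟨c i, hc i⟩, Algebra.toSubmodule_eq_top,
      Algebra.adjoin_range_eq_range_aeval] at hspan
    exact (AlgHom.range_eq_top _).mp hspan
  have hker : RingHom.ker π ≤ RingHom.ker Φ := by
    refine (ker_aeval_eq_span b c hc hli).trans_le ?_
    rw [Ideal.span_le]
    rintro _ ⟨i, rfl⟩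
    have h1 : z (c i) = y (b i) ^ p := by
      rw [← map_pow, ← hc]
      rfl
    change Φ _ = 0
    rw [map_sub, map_pow, sub_eq_zero]
    change MvPolynomial.eval₂Hom _ _ _ ^ p = MvPolynomial.eval₂Hom _ _ _
    rw [MvPolynomial.eval₂Hom_X', MvPolynomial.eval₂Hom_C]
    change _ = TrivSqZeroExt.inl (z (c i)) + TrivSqZeroExt.inr (d (c i))
    ext
    · simp [h1]
    · simp [hdc]
  let Ψ : B →+* DualNumber k := RingHom.liftOfSurjective π hπ ⟨Φ, hker⟩
  have hΨ : ∀ P, Ψ (π P) = Φ P := RingHom.liftOfRightInverse_comp_apply _ _ _ _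
  have hΨF : ∀ a, Ψ (algebraMap F B a) = TrivSqZeroExt.inl (z a) + TrivSqZeroExt.inr (d a) := by
    intro a
    have h1 : π (MvPolynomial.C a) = algebraMap F B a := MvPolynomial.aeval_C _ _
    rw [← h1, hΨ]
    exact MvPolynomial.eval₂Hom_C _ _ _
  have hΨb : ∀ i, Ψ (b i) = TrivSqZeroExt.inl (y (b i)) + TrivSqZeroExt.inr (u i) := by
    intro i
    have h1 : π (MvPolynomial.X i) = b i := MvPolynomial.aeval_X _ _
    rw [← h1, hΨ, h1]
    exact MvPolynomial.eval₂Hom_X' _ _ _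
  have hfst : ∀ a, (Ψ a).fst = y a := by
    intro a
    have h1 : ((TrivSqZeroExt.fstHom k k k).toRingHom.comp Ψ).comp π = y.toRingHom.comp π := by
      refine MvPolynomial.ringHom_ext (fun a => ?_) fun i => ?_
      · have h1 : π (MvPolynomial.C a) = algebraMap F B a := MvPolynomial.aeval_C _ _
        change (Ψ (π _)).fst = y (π _)
        rw [h1, hΨF]
        simp [z]
      · have h1 : π (MvPolynomial.X i) = b i := MvPolynomial.aeval_X _ _
        change (Ψ (π _)).fst = y (π _)
        rw [h1, hΨb]
        simp
    obtain ⟨P, rfl⟩ := hπ a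
    exact RingHom.congr_fun h1 P
  have hΨk : ∀ r : k, Ψ (algebraMap k B r) = TrivSqZeroExt.inl r := by
    intro r
    rw [IsScalarTower.algebraMap_apply k F B, hΨF, hd.map_algebraMap]
    simp
  refine ⟨
    { toFun := fun a => (Ψ a).snd
      map_add' := fun a b => by simp
      map_smul' := fun r a => by simp [Algebra.smul_def, hΨk] }, fun a b => ?_, fun a => ?_,
    fun i => ?_⟩
  · change (Ψ (a * b)).snd = y a * (Ψ b).snd + y b * (Ψ a).snd
    rw [map_mul, TrivSqZeroExt.snd_mul, hfst, hfst]
    simp [mul_comm]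
  · change (Ψ _).snd = _
    rw [hΨF]
    simp
  · change (Ψ _).snd = _
    rw [hΨb]
    simp

/-- Rational points extend uniquely along purely inseparable extensions of height one. -/
theorem exists_comp_val_eq {A : Type*} [CommRing A] [IsDomain A] [Algebra k A] (B : Subalgebra k A)
    (hB : pthPowers k p A ≤ B) (y : B →ₐ[k] k) : ∃ x : A →ₐ[k] k, x.comp B.val = y := by
  let φ : A →+* k := (frobeniusEquiv k p).symm.toRingHom.comp
    ((y.comp (Subalgebra.inclusion hB)).toRingHom.comp (equivPthPowers k p A).toRingHom)
  have hφ : ∀ a : A, φ a ^ p = y ⟨a ^ p, hB ⟨a, rfl⟩⟩ := fun a =>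
    frobeniusEquiv_symm_pow_p k p _
  have hφB : ∀ b : B, φ b = y b := fun b => by
    apply frobenius_inj k p
    rw [frobenius_def, frobenius_def, hφ, ← map_pow]
    rfl
  refine ⟨{ φ with
    commutes' := fun r => ?_ }, ?_⟩
  · have := hφB (algebraMap k B r)
    rw [AlgHom.commutes] at this
    exact this
  · ext b
    exact hφB b

end PthPowers

/-! ### Smooth points of the quotient -/

section SmoothPoints

variable {k : Type*} [Field k] [IsAlgClosed k] {p : ℕ} [hp : Fact p.Prime] [CharP k p]

theorem finiteDimensional_pthPowersField_bot (E K : Type*) [Field E] [Field K] [Algebra k E]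
    [Algebra k K] [Algebra E K] [IsScalarTower k E K] [FiniteDimensional E K]
    [FiniteDimensional (pthPowersField k p K) K] : FiniteDimensional (pthPowersField k p E) E := by
  refine Module.finite_of_finrank_pos ?_
  rw [finrank_pthPowersField_eq E K]
  exact Module.finrank_pos

theorem pow_card_le_finrank_pthPowersField {A : Type*} [CommRing A] [IsDomain A] [Algebra k A]
    (K : Type*) [Field K] [Algebra A K] [IsFractionRing A K] [Algebra k K] [IsScalarTower k A K]
    [FiniteDimensional (pthPowersField k p K) K] {ι : Type*} [Fintype ι] (y : A →ₐ[k] k)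
    [Algebra.FormallySmooth k (Localization.AtPrime (RingHom.ker y))] (b : ι → A)
    (hb : LinearIndependent k fun i => cotangentClass y (b i)) :
    p ^ Fintype.card ι ≤ Module.finrank (pthPowersField k p K) K := by
  classical
  have h := linearIndependent_redMonomial_pthPowersField (p := p) K y b hb
  simpa using h.fintype_card_le_finrank

namespace PLieAction

variable {𝔤 A : Type*} [LieRing 𝔤] [LieAlgebra k 𝔤] [PLieAlgebra k p 𝔤] [CommRing A] [IsDomain A]
  [Algebra k A] (K : Type*) [Field K] [Algebra A K] [IsFractionRing A K] [Algebra k K]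
  [IsScalarTower k A K]

instance isScalarTower_pthPowers_invariants (act : PLieAction k p 𝔤 A) :
    IsScalarTower k (pthPowers k p A) act.invariants :=
  .of_algebraMap_eq fun _ => rfl

/-- `K^𝔤` as an algebra over `A^𝔤`. -/
noncomputable instance algebraInvariantField (act : PLieAction k p 𝔤 A) :
    Algebra act.invariants (act.invariantField K) :=
  (((algebraMap A K).comp act.invariants.val.toRingHom).codRestrict (act.invariantField K)
    fun b => (act.algebraMap_mem_invariantField_iff K b).mpr b.2).toAlgebra

instance isScalarTower_invariantField (act : PLieAction k p 𝔤 A) :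
    IsScalarTower k act.invariants (act.invariantField K) :=
  .of_algebraMap_eq fun c => Subtype.ext (IsScalarTower.algebraMap_apply k A K c)

instance isFractionRing_invariantField (act : PLieAction k p 𝔤 A) :
    IsFractionRing act.invariants (act.invariantField K) := by
  have hinj : Function.Injective (algebraMap act.invariants (act.invariantField K)) := by
    intro a b h
    exact Subtype.ext (IsFractionRing.injective A K (Subtype.ext_iff.mp h))
  have : FaithfulSMul act.invariants (act.invariantField K) :=
    (faithfulSMul_iff_algebraMap_injective _ _).mpr hinj
  refine IsFractionRing.of_field _ _ fun z => ?_
  obtain ⟨a, s, hs, hz⟩ := IsFractionRing.div_surjective (A := A) (z : K)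
  have hs0 : algebraMap A K s ≠ 0 := IsFractionRing.to_map_ne_zero_of_mem_nonZeroDivisors hs
  have hsp : s ^ p ∈ act.invariants := act.pthPowers_le_invariants ⟨s, rfl⟩
  have h1 : (z : K) = algebraMap A K (a * s ^ (p - 1)) / algebraMap A K (s ^ p) := by
    have h2 : algebraMap A K s ^ p = algebraMap A K s ^ (p - 1) * algebraMap A K s := by
      rw [← pow_succ, Nat.sub_add_cancel hp.out.one_le]
    rw [← hz, map_mul, map_pow, map_pow, h2]
    field_simp
  have ha : a * s ^ (p - 1) ∈ act.invariants := by
    rw [← act.algebraMap_mem_invariantField_iff K]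
    have h2 := mul_mem z.2 ((act.algebraMap_mem_invariantField_iff K _).mpr hsp)
    rwa [h1, div_mul_cancel₀] at h2
    rw [map_pow]
    exact pow_ne_zero _ hs0
  exact ⟨⟨_, ha⟩, ⟨_, hsp⟩, Subtype.ext h1⟩

/-- Over a smooth point of the quotient the differentials of the generating invariants are linearly
independent. -/
theorem linearIndependent_cotangentClass_of_formallySmooth [Algebra.FiniteType k A]
    (act : PLieAction k p 𝔤 A) {n : ℕ} (f : Fin n → act.invariants)
    (hli : LinearIndependent (pthPowers k p A) (redMonomial (p := p) f))
    (hspan : Submodule.span (pthPowers k p A) (Set.range (redMonomial (p := p) f)) = ⊤)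
    (x : A →ₐ[k] k)
    [Algebra.FormallySmooth k (Localization.AtPrime (RingHom.ker (act.quotientMap x)))] :
    LinearIndependent k fun i => cotangentClass x (f i : A) := by
  have := finiteDimensional_cotangent x
  let V := (RingHom.ker x).Cotangent
  let W : Submodule k V := Submodule.span k (Set.range fun i => cotangentClass x (f i : A))
  let w := Module.finBasis k W
  obtain ⟨m, g, hgli, hgspan⟩ := exists_sumElim_basis (fun i => (w i : V))
    (w.linearIndependent.map' W.subtype W.ker_subtype)
  choose a _ ha using fun i => cotangentClass_surjective x (Sum.elim (fun i => (w i : V)) g i)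
  have haspan : Submodule.span k (Set.range fun i => cotangentClass x (a i)) = ⊤ := by
    rwa [show (fun i => cotangentClass x (a i)) = _ from funext ha]
  obtain ⟨φ, hφ⟩ := exists_dual_family hgli
  have hφW : ∀ l, ∀ v ∈ W, φ (Sum.inr l) v = 0 := by
    intro l v hv
    have h1 : φ (Sum.inr l) ∘ₗ W.subtype = 0 := w.ext fun i => hφ (Sum.inr l) (Sum.inl i)
    exact LinearMap.congr_fun h1 (⟨v, hv⟩ : W)
  let δ : Fin m → A →ₗ[k] k := fun l => φ (Sum.inr l) ∘ₗ cotangentClass x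
  have hδ : ∀ l, IsPointDerivation x (δ l) := fun l => isPointDerivation_dual_cotangentClass x _
  have hδf : ∀ l i, δ l (f i : A) = 0 := fun l i => hφW l _ (Submodule.subset_span ⟨i, rfl⟩)
  have hδa : ∀ l j, δ l (a (Sum.inr j)) = if l = j then 1 else 0 := fun l j => by
    have h1 := hφ (Sum.inr l) (Sum.inr j)
    rw [← ha] at h1
    exact h1.trans (by simp)
  choose d hd hdp using fun l => (hδ l).exists_pthPowers (p := p)
  let c : Fin n → pthPowers k p A := fun i => equivPthPowers k p A (f i)
  have hc : ∀ i, algebraMap (pthPowers k p A) act.invariants (c i) = f i ^ p := fun i =>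
    Subtype.ext rfl
  choose E hE hEF hEf using fun i : Fin n => IsPointDerivation.exists_extension f c hc hli hspan
    (act.quotientMap x) 0 (fun _ _ => by simp) (fun _ => rfl) (Pi.single i 1)
  choose E' hE' hEF' hEf' using fun l : Fin m => IsPointDerivation.exists_extension f c hc hli hspan
    (act.quotientMap x) (d l) (hd l) (fun i => by rw [hdp, hδf, zero_pow hp.out.ne_zero]) 0
  let b : Fin n ⊕ Fin m → act.invariants := Sum.elim f fun l =>
    algebraMap (pthPowers k p A) act.invariants (equivPthPowers k p A (a (Sum.inr l)))
  have hb : LinearIndependent k fun i => cotangentClass (act.quotientMap x) (b i) := by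
    rw [linearIndependent_cotangentClass_iff]
    refine ⟨Sum.elim E E', ?_, ?_⟩
    · rintro (i | l)
      · exact hE i
      · exact hE' l
    · rintro (i | l) (j | l')
      · simp [b, hEf, Pi.single_apply, eq_comm]
      · simp [b, hEF]
      · simp [b, hEf']
      · simp [b, hEF', hdp, hδa, hp.out.ne_zero]
  let K := FractionRing A
  obtain ⟨hK, hKle⟩ := finiteDimensional_and_finrank_le_of_cotangentClass (p := p) K x a haspan
  have := act.finiteDimensional_invariantField K
  have hEK := finrank_pthPowersField_eq (p := p) (k := k) (act.invariantField K) K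
  have := finiteDimensional_pthPowersField_bot (k := k) (p := p) (act.invariantField K) K
  have hle := pow_card_le_finrank_pthPowersField (p := p) (act.invariantField K)
    (act.quotientMap x) b hb
  rw [hEK] at hle
  have hle' := hle.trans hKle
  rw [Nat.pow_le_pow_iff_right hp.out.one_lt, Fintype.card_sum, Fintype.card_sum, Fintype.card_fin,
    Fintype.card_fin, Fintype.card_fin] at hle'
  rw [linearIndependent_iff_card_le_finrank_span, Fintype.card_fin]
  change n ≤ Module.finrank k W
  omega

end PLieAction

end SmoothPoints

/-! ### Smoothness of extensions by `p`-th roots -/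

/-- Extracting `p`-th roots of elements with dual derivations preserves smoothness. -/
theorem formallySmooth_of_redMonomial {p : ℕ} [hp : Fact p.Prime] {k O W ι : Type*} [Fintype ι]
    [DecidableEq ι] [CommRing k] [CommRing O] [CharP O p] [Algebra k O]
    [Algebra.FormallySmooth k O] [CommRing W] [Algebra k W] [Algebra O W] [IsScalarTower k O W]
    (b : ι → W) (c : ι → O) (hc : ∀ i, algebraMap O W (c i) = b i ^ p)
    (hli : LinearIndependent O (redMonomial (p := p) b))
    (hspan : Submodule.span O (Set.range (redMonomial (p := p) b)) = ⊤)
    (D : ι → Derivation k O O) (hD : ∀ i j, D i (c j) = if i = j then 1 else 0) :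
    Algebra.FormallySmooth k W := by
  have : Algebra.FormallySmooth k (MvPolynomial ι O) :=
    Algebra.FormallySmooth.comp k O (MvPolynomial ι O)
  let π : MvPolynomial ι O →ₐ[k] W := (MvPolynomial.aeval b).restrictScalars k
  have hπ : Function.Surjective π := by
    rw [span_redMonomial_eq_adjoin b fun i => ⟨c i, hc i⟩, Algebra.toSubmodule_eq_top,
      Algebra.adjoin_range_eq_range_aeval] at hspan
    exact (AlgHom.range_eq_top (MvPolynomial.aeval b : MvPolynomial ι O →ₐ[O] W)).mp hspan
  let J : Ideal (MvPolynomial ι O) := RingHom.ker π.toRingHom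
  let G : ι → MvPolynomial ι O := fun i => MvPolynomial.X i ^ p - MvPolynomial.C (c i)
  have hJ : J = Ideal.span (Set.range G) := ker_aeval_eq_span b c hc hli
  have hGJ : ∀ i, G i ∈ J := fun i => hJ ▸ Ideal.subset_span ⟨i, rfl⟩
  let L : O →ₗ[k] MvPolynomial ι O := ∑ i, (LinearMap.mulRight k (G i)) ∘ₗ
    (Algebra.linearMap O (MvPolynomial ι O)).restrictScalars k ∘ₗ (D i).toLinearMap
  have hL : ∀ a, L a = ∑ i, MvPolynomial.C (D i a) * G i := fun a => by
    simp only [L, LinearMap.sum_apply]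
    rfl
  have hLJ : ∀ a, L a ∈ J := fun a => by
    rw [hL]
    exact sum_mem fun i _ => Ideal.mul_mem_left _ _ (hGJ i)
  let θ₀ : O →ₐ[k] MvPolynomial ι O ⧸ J ^ 2 := AlgHom.ofLinearMap
    ((Ideal.Quotient.mkₐ k (J ^ 2)).toLinearMap ∘ₗ
      ((IsScalarTower.toAlgHom k O (MvPolynomial ι O)).toLinearMap + L))
    (by
      change Ideal.Quotient.mk (J ^ 2) (MvPolynomial.C 1 + L 1) = 1
      simp [hL])
    (fun a a' => by
      change Ideal.Quotient.mk (J ^ 2) (MvPolynomial.C (a * a') + L (a * a')) =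
        Ideal.Quotient.mk (J ^ 2) (MvPolynomial.C a + L a) *
          Ideal.Quotient.mk (J ^ 2) (MvPolynomial.C a' + L a')
      have h1 : L (a * a') = MvPolynomial.C a * L a' + MvPolynomial.C a' * L a := by
        simp only [hL, Finset.mul_sum, ← Finset.sum_add_distrib]
        refine Finset.sum_congr rfl fun i _ => ?_
        simp only [Derivation.leibniz, smul_eq_mul, map_add, map_mul]
        ring
      rw [← map_mul, ← sub_eq_zero, ← map_sub, Ideal.Quotient.eq_zero_iff_mem, h1, map_mul, pow_two]
      convert neg_mem (Ideal.mul_mem_mul (hLJ a) (hLJ a')) using 1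
      ring)
  let θ : MvPolynomial ι O →+* MvPolynomial ι O ⧸ J ^ 2 :=
    MvPolynomial.eval₂Hom θ₀.toRingHom fun i => Ideal.Quotient.mk (J ^ 2) (MvPolynomial.X i)
  have hθC : ∀ a, θ (MvPolynomial.C a) = Ideal.Quotient.mk (J ^ 2) (MvPolynomial.C a + L a) :=
    fun a => MvPolynomial.eval₂Hom_C _ _ _
  have hθX : ∀ i, θ (MvPolynomial.X i) = Ideal.Quotient.mk (J ^ 2) (MvPolynomial.X i) :=
    fun a => MvPolynomial.eval₂Hom_X' _ _ _
  have hker : RingHom.ker π.toRingHom ≤ RingHom.ker θ := by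
    refine hJ.le.trans ?_
    rw [Ideal.span_le]
    rintro _ ⟨i, rfl⟩
    change θ (G i) = 0
    have h1 : L (c i) = G i := by
      rw [hL, Finset.sum_eq_single i]
      · simp [hD]
      · intro j _ hji
        simp [hD, hji]
      · simp
    rw [map_sub, map_pow, hθC, hθX, ← map_pow, ← map_sub, h1]
    simp [G]
  let Ψ : W →+* MvPolynomial ι O ⧸ J ^ 2 := RingHom.liftOfSurjective π.toRingHom hπ ⟨θ, hker⟩
  have hΨ : ∀ P, Ψ (π P) = θ P := RingHom.liftOfRightInverse_comp_apply _ _ _ _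
  let g : W →ₐ[k] MvPolynomial ι O ⧸ J ^ 2 :=
    { Ψ with
      commutes' := fun r => by
        change Ψ (algebraMap k W r) = _
        have h1 : algebraMap k W r = π (MvPolynomial.C (algebraMap k O r)) := by
          rw [← MvPolynomial.algebraMap_eq, ← IsScalarTower.algebraMap_apply, π.commutes]
        rw [h1, hΨ]
        exact (MvPolynomial.eval₂Hom_C _ _ _).trans (θ₀.commutes r) }
  refine Algebra.FormallySmooth.of_split π g (AlgHom.ext fun w => ?_)
  obtain ⟨P, rfl⟩ := hπ w
  have h1 : (π.kerSquareLift.toRingHom.comp θ) = π.toRingHom := by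
    refine MvPolynomial.ringHom_ext (fun a => ?_) fun i => ?_
    · change π.kerSquareLift (θ (MvPolynomial.C a)) = _
      rw [hθC]
      change π (MvPolynomial.C a + L a) = π (MvPolynomial.C a)
      rw [map_add, show π (L a) = 0 from hLJ a, add_zero]
    · change π.kerSquareLift (θ (MvPolynomial.X i)) = _
      rw [hθX]
      rfl
  change π.kerSquareLift (Ψ (π P)) = π P
  rw [hΨ]
  exact RingHom.congr_fun h1 P

theorem formallySmooth_localization_of_redMonomial {p : ℕ} [hp : Fact p.Prime] {k F B ι : Type*}
    [Fintype ι] [DecidableEq ι] [Field k] [CharP k p] [CommRing F] [Algebra k F]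
    [Algebra.FormallySmooth k F] [CommRing B] [IsDomain B] [Algebra k B] [Algebra F B]
    [IsScalarTower k F B] (b : ι → B) (c : ι → F) (hc : ∀ i, algebraMap F B (c i) = b i ^ p)
    (hli : LinearIndependent F (redMonomial (p := p) b))
    (hspan : Submodule.span F (Set.range (redMonomial (p := p) b)) = ⊤)
    (hpow : ∀ s : B, s ^ p ∈ (algebraMap F B).range) (y : B →ₐ[k] k)
    (hy : LinearIndependent k fun i =>
      cotangentClass (y.comp (IsScalarTower.toAlgHom k F B)) (c i)) :
    Algebra.FormallySmooth k (Localization.AtPrime (RingHom.ker y)) := by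
  set x := y.comp (IsScalarTower.toAlgHom k F B)
  have : Algebra.FormallySmooth F (Localization.AtPrime (RingHom.ker x)) :=
    Algebra.FormallySmooth.of_isLocalization (RingHom.ker x).primeCompl
  have : Algebra.FormallySmooth k (Localization.AtPrime (RingHom.ker x)) :=
    Algebra.FormallySmooth.comp k F _
  have : (RingHom.ker y).LiesOver (RingHom.ker x) := ⟨rfl⟩
  let := Localization.AtPrime.algebraOfLiesOver (RingHom.ker x) (RingHom.ker y)
  obtain ⟨D, hD⟩ := exists_dual_derivation_localization x c hy
  have htower : IsScalarTower F (Localization.AtPrime (RingHom.ker x))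
    (Localization.AtPrime (RingHom.ker y)) := inferInstance
  have htower' : IsScalarTower k (Localization.AtPrime (RingHom.ker x))
    (Localization.AtPrime (RingHom.ker y)) := inferInstance
  set O := Localization.AtPrime (RingHom.ker x)
  set W := Localization.AtPrime (RingHom.ker y)
  have hinj : Function.Injective (algebraMap B W) :=
    IsLocalization.injective W (RingHom.ker y).primeCompl_le_nonZeroDivisors
  have hchar : CharP O p := charP_of_injective_algebraMap (algebraMap k O).injective p
  have hmap : ∀ α, redMonomial (p := p) (fun i => algebraMap B W (b i)) α =
      (Algebra.linearMap B W).restrictScalars F (redMonomial b α) := fun α =>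
    (map_redMonomial (algebraMap B W) b α).symm
  refine formallySmooth_of_redMonomial (p := p) (fun i => algebraMap B W (b i))
    (fun i => algebraMap F O (c i)) (fun i => ?_) ?_ ?_ D hD
  · rw [← IsScalarTower.algebraMap_apply F O W, IsScalarTower.algebraMap_apply F B W, hc, map_pow]
  · refine LinearIndependent.localization O (RingHom.ker x).primeCompl ?_
    rw [show redMonomial (p := p) (fun i => algebraMap B W (b i)) = _ from funext hmap]
    exact hli.map' _ (LinearMap.ker_eq_bot.mpr hinj)
  · rw [eq_top_iff]
    rintro w -
    obtain ⟨a, s, rfl⟩ := IsLocalization.exists_mk'_eq (RingHom.ker y).primeCompl w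
    obtain ⟨t, ht⟩ := hpow s
    have htx : t ∈ (RingHom.ker x).primeCompl := by
      change y (algebraMap F B t) ≠ 0
      rw [ht, map_pow]
      exact pow_ne_zero _ s.2
    have h1 : IsLocalization.mk' W a s =
        IsLocalization.mk' O 1 ⟨t, htx⟩ • algebraMap B W (a * s ^ (p - 1)) := by
      rw [IsLocalization.mk'_eq_iff_eq_mul, Algebra.smul_def, mul_assoc, ← map_mul, mul_assoc,
        ← pow_succ, Nat.sub_add_cancel hp.out.one_le, ← ht, map_mul, mul_left_comm,
        ← IsScalarTower.algebraMap_apply F B W, IsScalarTower.algebraMap_apply F O W, ← map_mul,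
        IsLocalization.mk'_spec O 1 (⟨t, htx⟩ : (RingHom.ker x).primeCompl), map_one, map_one,
        mul_one]
    rw [h1]
    refine Submodule.smul_mem _ _ ?_
    have h2 : a * s ^ (p - 1) ∈ Submodule.span F (Set.range (redMonomial (p := p) b)) :=
      hspan ▸ Submodule.mem_top
    obtain ⟨u, hu⟩ := (Submodule.mem_span_range_iff_exists_fun F).mp h2
    rw [← hu, map_sum]
    refine sum_mem fun α _ => ?_
    rw [Algebra.smul_def, map_mul, ← IsScalarTower.algebraMap_apply F B W,
      IsScalarTower.algebraMap_apply F O W, ← Algebra.smul_def]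
    exact Submodule.smul_mem _ _ (Submodule.subset_span ⟨α, hmap α⟩)

section SmoothPoints

variable {k : Type*} [Field k] [IsAlgClosed k] {p : ℕ} [hp : Fact p.Prime] [CharP k p]

theorem formallySmooth_pthPowers (A : Type*) [CommRing A] [IsDomain A] [Algebra k A]
    [Algebra.FormallySmooth k A] : Algebra.FormallySmooth k (pthPowers k p A) := by
  rw [← RingHom.formallySmooth_algebraMap]
  have h : algebraMap k (pthPowers k p A) = (equivPthPowers k p A).toRingHom.comp
      ((algebraMap k A).comp (frobeniusEquiv k p).symm.toRingHom) := by
    ext c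
    change algebraMap k A c = algebraMap k A ((frobeniusEquiv k p).symm c) ^ p
    rw [← map_pow, frobeniusEquiv_symm_pow_p]
  rw [h]
  exact ((RingHom.FormallySmooth.of_bijective (frobeniusEquiv k p).symm.bijective).comp
    (RingHom.formallySmooth_algebraMap.mpr ‹_›)).comp
    (RingHom.FormallySmooth.of_bijective (equivPthPowers k p A).bijective)

namespace PLieAction

variable {𝔤 A : Type*} [LieRing 𝔤] [LieAlgebra k 𝔤] [PLieAlgebra k p 𝔤] [CommRing A] [IsDomain A]
  [Algebra k A]

/-- The quotient is smooth at the image of a point where the differentials of the generating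
invariants are linearly independent. -/
theorem formallySmooth_quotientMap [Algebra.FormallySmooth k A]
    (act : PLieAction k p 𝔤 A) {n : ℕ} (f : Fin n → act.invariants)
    (hli : LinearIndependent (pthPowers k p A) (redMonomial (p := p) f))
    (hspan : Submodule.span (pthPowers k p A) (Set.range (redMonomial (p := p) f)) = ⊤)
    (x : A →ₐ[k] k) (hx : LinearIndependent k fun i => cotangentClass x (f i : A)) :
    Algebra.FormallySmooth k (Localization.AtPrime (RingHom.ker (act.quotientMap x))) := by
  have := formallySmooth_pthPowers (k := k) (p := p) A
  refine formallySmooth_localization_of_redMonomial (p := p) f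
    (fun i => equivPthPowers k p A (f i)) (fun i => Subtype.ext rfl) hli hspan
    (fun s => ⟨equivPthPowers k p A s, Subtype.ext rfl⟩) _ ?_
  obtain ⟨δ, hδ, hδf⟩ := (linearIndependent_cotangentClass_iff x _).mp hx
  choose d hd hdp using fun i => (hδ i).exists_pthPowers (p := p)
  refine (linearIndependent_cotangentClass_iff _ _).mpr ⟨d, hd, fun i j => ?_⟩
  rw [hdp, hδf]
  split_ifs
  · exact one_pow p
  · exact zero_pow hp.out.ne_zero

end PLieAction

end SmoothPoints

theorem theorem5p4 {k : Type*} [Field k] [IsAlgClosed k] {p : ℕ} [Fact p.Prime] [CharP k p]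
    {A : Type*} [CommRing A] [IsDomain A] [Algebra k A] [Algebra.Smooth k A]
    (K : Type*) [Field K] [Algebra A K] [IsFractionRing A K] [Algebra k K] [IsScalarTower k A K]
    {𝔤 : Type*} [LieRing 𝔤] [LieAlgebra k 𝔤] [PLieAlgebra k p 𝔤]
    (act : PLieAction k p 𝔤 A) (n : ℕ)
    (hn : ((n + act.maxCodim : ℕ∞) : WithBot ℕ∞) = ringKrullDim A)
    (f : Fin n → A) (hf : ∀ i, f i ∈ act.invariants)
    (hU : (independenceLocus k f).Nonempty) :
    act.invariantField K =
        (IntermediateField.adjoin (pthPowersField k p K)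
          (Set.range fun i => algebraMap A K (f i))).restrictScalars k ∧
      (2 ≤ codimension (independenceLocus k f)ᶜ →
        (act.invariants =
            (Algebra.adjoin (pthPowers k p A) (Set.range f)).restrictScalars k ∧
          Module.Free (pthPowers k p A) act.invariants ∧
          Module.finrank (pthPowers k p A) act.invariants = p ^ n) ∧
        IsLocallyCompleteIntersection act.invariants ∧
        act.quotientMap '' independenceLocus k f =
          {y : act.invariants →ₐ[k] k | IsSmoothPoint y}) := by
  obtain ⟨x₀, hx₀⟩ := hU
  have hne : Nonempty (A →ₐ[k] k) := ⟨x₀⟩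
  have hU : ∀ x ∈ independenceLocus k f, LinearIndependent k fun i => cotangentClass x (f i) :=
    fun x hx => (linearIndependent_differentialAt_iff x f).mp hx
  have hliK := linearIndependent_redMonomial_pthPowersField (p := p) K x₀ f (hU x₀ hx₀)
  have hK := act.invariantField_eq_adjoin K n hn f hf hliK
  refine ⟨hK, fun hcodim => ?_⟩
  have hA := act.invariants_eq_adjoin K f hf hK hcodim
  let g : Fin n → act.invariants := fun i => ⟨f i, hf i⟩
  have hli := act.linearIndependent_redMonomial_invariants K g hliK
  have hspan := act.span_redMonomial_invariants g hA
  let b := Module.Basis.mk hli hspan.ge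
  refine ⟨⟨hA, .of_basis b, ?_⟩, act.isLocallyCompleteIntersection_invariants g hli hspan, ?_⟩
  · simp [Module.finrank_eq_card_basis b]
  · ext y
    constructor
    · rintro ⟨x, hx, rfl⟩
      exact act.formallySmooth_quotientMap g hli hspan x (hU x hx)
    · intro hy
      obtain ⟨x, rfl⟩ := exists_comp_val_eq act.invariants act.pthPowers_le_invariants y
      have : Algebra.FormallySmooth k (Localization.AtPrime (RingHom.ker (act.quotientMap x))) := hy
      exact ⟨x, (linearIndependent_differentialAt_iff x f).mpr
        (act.linearIndependent_cotangentClass_of_formallySmooth g hli hspan x), rfl⟩
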